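/- Let $M$ be a smooth (finite-dimensional, boundaryless) manifold with an almost contact metric structure $(\phi,\xi,\eta,g)$: $\phi$ is a smooth $(1,1)$-tensor field, $\xi$ a smooth vector field, $\eta$ a smooth $1$-form and $g$ a smooth Riemannian metric such that $$\phi^2=-I+\eta\otimes\xi,\qquad \eta(\xi)=1,\qquad g(\phi X,\phi Y)=g(X,Y)-\eta(X)\eta(Y)$$ for all vector fields $X,Y$. Suppose that $(M,\phi,\xi,\eta,g)$ is coKähler, that is: - the $1$-form $\eta$ and the fundamental $2$-form $\Phi(X,Y)=g(X,\phi Y)$ are closed, and - the structure is normal: the almost complex structure $J\left(X,f\frac{d}{dt}\right)=\left(\phi X-f\xi,\ \eta(X)\frac{d}{dt}\right)$ on $M\times\mathbb{R}$ is integrable, i.e. its Nijenhuis torsion $[J,J]$ vanishes. Let $\nabla$ be the Levi-Civita connection of $g$, let $R(X,Y)Z=\nabla_X\nabla_YZ-\nabla_Y\nabla_XZ-\nabla_{[X,Y]}Z$ be its curvature, let $\mathrm{Ric}(X,Y)=\sum_i g(R(E_i,X)Y,E_i)$ (for any local orthonormal frame $\{E_i\}$) be the Ricci tensor, and let $\mathrm{Ric}^\sharp$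 be the Ricci operator, defined by $g(\mathrm{Ric}^\sharp X,Y)=\mathrm{Ric}(X,Y)$. Then $\mathrm{Ric}^\sharp$ commutes with $\phi$: for every $x\in M$ and every $v\in T_xM$, $$\phi(\mathrm{Ric}^\sharp v)=\mathrm{Ric}^\sharp(\phi v).$$ -/

import Mathlib

open Bundle FiberBundle VectorField
open scoped Manifold ContDiff

noncomputable section
namespace CoKahler

variable {E : Type*} [NormedAddCommGroup E] [NormedSpace ℝ E]
  {M : Type*} [TopologicalSpace M] [ChartedSpace E M] [IsManifold 𝓘(ℝ, E) ∞ M]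

/-- Vector fields on `M` (smoothness is stated separately where it is needed). -/
abbrev TangentField (E M : Type*) [NormedAddCommGroup E] [NormedSpace ℝ E]
    [TopologicalSpace M] [ChartedSpace E M] := ∀ x : M, TangentSpace 𝓘(ℝ, E) x

/-- Smooth Riemannian metrics on `M`; `g.inner x v w` is `g_x(v, w)`. -/
abbrev RiemannianMetric (E M : Type*) [NormedAddCommGroup E] [NormedSpace ℝ E]
    [TopologicalSpace M] [ChartedSpace E M] [IsManifold 𝓘(ℝ, E) ∞ M] :=
  ContMDiffRiemannianMetric 𝓘(ℝ, E) ∞ E (fun x : M ↦ TangentSpace 𝓘(ℝ, E) x)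

/-- A `1`-form `η` is closed: `dη(X, Y) = X (η(Y)) - Y (η(X)) - η([X, Y])` vanishes at every point,
for all vector fields that are smooth at that point. -/
def IsClosedOneForm (η : ∀ x : M, TangentSpace 𝓘(ℝ, E) x → ℝ) : Prop :=
  ∀ (x : M) (X Y : TangentField E M), CMDiffAt ∞ (T% X) x → CMDiffAt ∞ (T% Y) x →
    d% (fun y ↦ η y (Y y)) x (X x) - d% (fun y ↦ η y (X y)) x (Y x)
      - η x (mlieBracket 𝓘(ℝ, E) X Y x) = 0

/-- A `2`-form `Φ` is closed: `dΦ(X, Y, Z)`, the cyclic sum of `X (Φ(Y, Z)) - Φ([X, Y], Z)`,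
vanishes at every point, for all vector fields that are smooth at that point. -/
def IsClosedTwoForm
    (Φ : ∀ x : M, TangentSpace 𝓘(ℝ, E) x → TangentSpace 𝓘(ℝ, E) x → ℝ) : Prop :=
  ∀ (x : M) (X Y Z : TangentField E M), CMDiffAt ∞ (T% X) x → CMDiffAt ∞ (T% Y) x →
    CMDiffAt ∞ (T% Z) x →
    d% (fun y ↦ Φ y (Y y) (Z y)) x (X x) + d% (fun y ↦ Φ y (Z y) (X y)) x (Y x)
      + d% (fun y ↦ Φ y (X y) (Y y)) x (Z x)
      - Φ x (mlieBracket 𝓘(ℝ, E) X Y x) (Z x) - Φ x (mlieBracket 𝓘(ℝ, E) Y Z x) (X x)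
      - Φ x (mlieBracket 𝓘(ℝ, E) Z X x) (Y x) = 0

/-- The Nijenhuis torsion `[J, J](X, Y) = J² [X, Y] + [JX, JY] - J [JX, Y] - J [X, JY]`. -/
def nijenhuis {F H N : Type*} [NormedAddCommGroup F] [NormedSpace ℝ F] [TopologicalSpace H]
    (I : ModelWithCorners ℝ F H) [TopologicalSpace N] [ChartedSpace H N]
    (J : ∀ p : N, TangentSpace I p → TangentSpace I p) (X Y : ∀ p : N, TangentSpace I p) (p : N) :
    TangentSpace I p :=
  J p (J p (mlieBracket I X Y p)) + mlieBracket I (fun q ↦ J q (X q)) (fun q ↦ J q (Y q)) p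
    - J p (mlieBracket I (fun q ↦ J q (X q)) Y p) - J p (mlieBracket I X (fun q ↦ J q (Y q)) p)

/-- An almost contact structure `(φ, ξ, η)`: smooth tensor fields with
`φ² = -I + η ⊗ ξ` and `η(ξ) = 1`. -/
structure AlmostContactStructure (E M : Type*) [NormedAddCommGroup E] [NormedSpace ℝ E]
    [TopologicalSpace M] [ChartedSpace E M] [IsManifold 𝓘(ℝ, E) ∞ M] where
  φ : ∀ x : M, TangentSpace 𝓘(ℝ, E) x →L[ℝ] TangentSpace 𝓘(ℝ, E) x
  ξ : ∀ x : M, TangentSpace 𝓘(ℝ, E) x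
  η : ∀ x : M, TangentSpace 𝓘(ℝ, E) x →L[ℝ] ℝ
  contMDiff_φ : ContMDiff 𝓘(ℝ, E) (𝓘(ℝ, E).prod 𝓘(ℝ, E →L[ℝ] E)) ∞
    (fun x ↦ TotalSpace.mk' (E →L[ℝ] E)
      (E := fun x : M ↦ TangentSpace 𝓘(ℝ, E) x →L[ℝ] TangentSpace 𝓘(ℝ, E) x) x (φ x))
  contMDiff_ξ : CMDiff ∞ (T% ξ)
  contMDiff_η : ContMDiff 𝓘(ℝ, E) (𝓘(ℝ, E).prod 𝓘(ℝ, E →L[ℝ] ℝ)) ∞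
    (fun x ↦ TotalSpace.mk' (E →L[ℝ] ℝ)
      (E := fun x : M ↦ TangentSpace 𝓘(ℝ, E) x →L[ℝ] ℝ) x (η x))
  φ_φ : ∀ x v, φ x (φ x v) = -v + η x v • ξ x
  η_ξ : ∀ x, η x (ξ x) = 1

namespace AlmostContactStructure

/-- The almost complex structure `J(X, f d/dt) = (φ X - f ξ, η(X) d/dt)` on `M × ℝ`, under the
identification `T_(x,t)(M × ℝ) = T_x M × ℝ`. -/
def productJ (S : AlmostContactStructure E M) (p : M × ℝ)
    (w : TangentSpace (𝓘(ℝ, E).prod 𝓘(ℝ, ℝ)) p) : TangentSpace (𝓘(ℝ, E).prod 𝓘(ℝ, ℝ)) p :=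
  let v : TangentSpace 𝓘(ℝ, E) p.1 := Prod.fst (α := E) (β := ℝ) w
  let a : ℝ := Prod.snd (α := E) (β := ℝ) w
  Prod.mk (α := E) (β := ℝ) (S.φ p.1 v - a • S.ξ p.1) (S.η p.1 v)

/-- The structure is normal: the almost complex structure `J` on `M × ℝ` is integrable, i.e. its
Nijenhuis torsion vanishes. -/
def IsNormal (S : AlmostContactStructure E M) : Prop :=
  ∀ (p : M × ℝ) (X Y : ∀ q : M × ℝ, TangentSpace (𝓘(ℝ, E).prod 𝓘(ℝ, ℝ)) q),
    CMDiffAt ∞ (T% X) p → CMDiffAt ∞ (T% Y) p →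
    nijenhuis (𝓘(ℝ, E).prod 𝓘(ℝ, ℝ)) S.productJ X Y p = 0

/-- The metric is compatible with the structure: `g(φX, φY) = g(X, Y) - η(X) η(Y)`. -/
def IsCompatible (S : AlmostContactStructure E M) (g : RiemannianMetric E M) : Prop :=
  ∀ (x : M) (v w : TangentSpace 𝓘(ℝ, E) x),
    g.inner x (S.φ x v) (S.φ x w) = g.inner x v w - S.η x v * S.η x w

/-- The fundamental `2`-form `Φ(X, Y) = g(X, φY)`. -/
def fundamentalForm (S : AlmostContactStructure E M) (g : RiemannianMetric E M) (x : M)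
    (v w : TangentSpace 𝓘(ℝ, E) x) : ℝ :=
  g.inner x v (S.φ x w)

/-- `(M, φ, ξ, η, g)` is a coKähler manifold: a normal almost contact metric manifold whose forms
`η` and `Φ` are closed. -/
structure IsCoKahler (S : AlmostContactStructure E M) (g : RiemannianMetric E M) : Prop where
  compatible : S.IsCompatible g
  closed_η : IsClosedOneForm (fun x v ↦ S.η x v)
  closed_Φ : IsClosedTwoForm (S.fundamentalForm g)
  normal : S.IsNormal

end AlmostContactStructure

/-- The right-hand side of the Koszul formula
`2 g(∇_X Y, Z) = X g(Y, Z) + Y g(X, Z) - Z g(X, Y) + g([X, Y], Z) - g([X, Z], Y) - g([Y, Z], X)`. -/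
def koszul (g : RiemannianMetric E M) (X Y Z : TangentField E M) (x : M) : ℝ :=
  d% (fun y ↦ g.inner y (Y y) (Z y)) x (X x) + d% (fun y ↦ g.inner y (X y) (Z y)) x (Y x)
    - d% (fun y ↦ g.inner y (X y) (Y y)) x (Z x)
    + g.inner x (mlieBracket 𝓘(ℝ, E) X Y x) (Z x)
    - g.inner x (mlieBracket 𝓘(ℝ, E) X Z x) (Y x)
    - g.inner x (mlieBracket 𝓘(ℝ, E) Y Z x) (X x)

theorem mdifferentiableAt_inner (g : RiemannianMetric E M) {X Y : TangentField E M} {x : M}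
    (hX : MDiffAt (T% X) x) (hY : MDiffAt (T% Y) x) :
    MDiffAt (fun y ↦ g.inner y (X y) (Y y)) x := by
  have : MDifferentiableAt 𝓘(ℝ, E) (𝓘(ℝ, E).prod 𝓘(ℝ))
      (fun m ↦ TotalSpace.mk' ℝ (E := Bundle.Trivial M ℝ) m (g.inner m (X m) (Y m))) x := by
    apply MDifferentiableAt.clm_bundle_apply₂ (F₁ := E) (F₂ := E)
    · exact g.contMDiff.contMDiffAt.mdifferentiableAt (by simp)
    · exact hX
    · exact hY
  simp only [mdifferentiableAt_totalSpace] at this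
  exact this.2

theorem koszul_sub_swap (g : RiemannianMetric E M) (X Y Z : TangentField E M) (x : M) :
    koszul g X Y Z x - koszul g Y X Z x = 2 * g.inner x (mlieBracket 𝓘(ℝ, E) X Y x) (Z x) := by
  have h (X Y : TangentField E M) : (fun y ↦ g.inner y (X y) (Y y)) =
    (fun y ↦ g.inner y (Y y) (X y)) := funext fun y ↦ g.symm y _ _
  simp [koszul, mlieBracket_swap_apply (V := Y) (W := X), h Y X]
  ring

theorem koszul_add_swap (g : RiemannianMetric E M) (X Y Z : TangentField E M) (x : M) :
    koszul g X Y Z x + koszul g X Z Y x = 2 * d% (fun y ↦ g.inner y (Y y) (Z y)) x (X x) := by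
  have h (X Y : TangentField E M) : (fun y ↦ g.inner y (X y) (Y y)) =
    (fun y ↦ g.inner y (Y y) (X y)) := funext fun y ↦ g.symm y _ _
  simp [koszul, mlieBracket_swap_apply (V := Z) (W := Y), h Z Y]
  ring

variable [FiniteDimensional ℝ E]

theorem koszul_tensorial_left (g : RiemannianMetric E M) {Y Z : TangentField E M} {x : M}
    (hY : MDiffAt (T% Y) x) (hZ : MDiffAt (T% Z) x) :
    TensorialAt 𝓘(ℝ, E) E (koszul g · Y Z x) x where
  smul {f X} hf hX := by
    have h1 := mdifferentiableAt_inner g hX hZ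
    have h2 := mdifferentiableAt_inner g hX hY
    simp [koszul, mvfderiv_fun_mul hf h1, mvfderiv_fun_mul hf h2, mlieBracket_smul_left hf hX]
    ring
  add {X X'} hX hX' := by
    simp [koszul, mlieBracket_add_left hX hX',
      mvfderiv_fun_add (mdifferentiableAt_inner g hX hZ) (mdifferentiableAt_inner g hX' hZ),
      mvfderiv_fun_add (mdifferentiableAt_inner g hX hY) (mdifferentiableAt_inner g hX' hY)]
    ring

theorem koszul_tensorial_right (g : RiemannianMetric E M) {X Y : TangentField E M} {x : M}
    (hX : MDiffAt (T% X) x) (hY : MDiffAt (T% Y) x) :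
    TensorialAt 𝓘(ℝ, E) E (koszul g X Y · x) x where
  smul {f Z} hf hZ := by
    simp [koszul, mvfderiv_fun_mul hf (mdifferentiableAt_inner g hX hZ),
      mvfderiv_fun_mul hf (mdifferentiableAt_inner g hY hZ), mlieBracket_smul_right hf hZ]
    rw [g.symm x (Z x) (X x), g.symm x (Z x) (Y x)]
    ring
  add {Z Z'} hZ hZ' := by
    simp [koszul, mlieBracket_add_right hZ hZ',
      mvfderiv_fun_add (mdifferentiableAt_inner g hX hZ) (mdifferentiableAt_inner g hX hZ'),
      mvfderiv_fun_add (mdifferentiableAt_inner g hY hZ) (mdifferentiableAt_inner g hY hZ')]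
    ring

theorem koszul_add_middle (g : RiemannianMetric E M) {X Y Y' Z : TangentField E M} {x : M}
    (hX : MDiffAt (T% X) x) (hY : MDiffAt (T% Y) x) (hY' : MDiffAt (T% Y') x)
    (hZ : MDiffAt (T% Z) x) :
    koszul g X (Y + Y') Z x = koszul g X Y Z x + koszul g X Y' Z x := by
  simp [koszul, mlieBracket_add_right hY hY', mlieBracket_add_left hY hY',
    mvfderiv_fun_add (mdifferentiableAt_inner g hX hY) (mdifferentiableAt_inner g hX hY'),
    mvfderiv_fun_add (mdifferentiableAt_inner g hY hZ) (mdifferentiableAt_inner g hY' hZ)]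
  ring

theorem koszul_smul_middle (g : RiemannianMetric E M) {X Y Z : TangentField E M} {f : M → ℝ} {x : M}
    (hX : MDiffAt (T% X) x) (hf : MDiffAt f x) (hY : MDiffAt (T% Y) x) (hZ : MDiffAt (T% Z) x) :
    koszul g X (f • Y) Z x =
      f x * koszul g X Y Z x + 2 * (d% f x (X x) * g.inner x (Y x) (Z x)) := by
  simp [koszul, mlieBracket_smul_right hf hY, mlieBracket_smul_left hf hY,
    mvfderiv_fun_mul hf (mdifferentiableAt_inner g hX hY),
    mvfderiv_fun_mul hf (mdifferentiableAt_inner g hY hZ)]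
  rw [g.symm x (Y x) (X x)]
  ring

theorem exists_orthonormal_basis (g : RiemannianMetric E M) (x : M) :
    ∃ b : Module.Basis (Fin (Module.finrank ℝ E)) ℝ (TangentSpace 𝓘(ℝ, E) x),
      ∀ i j, g.inner x (b i) (b j) = if i = j then 1 else 0 := by
  let _ : RiemannianBundle (fun x : M ↦ TangentSpace 𝓘(ℝ, E) x) := ⟨g.toRiemannianMetric⟩
  let V := TangentSpace 𝓘(ℝ, E) x
  let _ : NormedAddCommGroup V := inferInstanceAs (NormedAddCommGroup
    ((fun x : M ↦ TangentSpace 𝓘(ℝ, E) x) x))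
  let _ : InnerProductSpace ℝ V := inferInstanceAs (InnerProductSpace ℝ
    ((fun x : M ↦ TangentSpace 𝓘(ℝ, E) x) x))
  have : FiniteDimensional ℝ V := inferInstanceAs (FiniteDimensional ℝ E)
  have hd : Module.finrank ℝ V = Module.finrank ℝ E := rfl
  let b := (stdOrthonormalBasis ℝ V).reindex (finCongr hd)
  refine ⟨b.toBasis, fun i j ↦ ?_⟩
  have := orthonormal_iff_ite.1 b.orthonormal i j
  simpa using! this

/-- A chosen `g`-orthonormal basis of the tangent space at `x`. -/
def orthonormalBasis (g : RiemannianMetric E M) (x : M) :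
    Module.Basis (Fin (Module.finrank ℝ E)) ℝ (TangentSpace 𝓘(ℝ, E) x) :=
  (exists_orthonormal_basis g x).choose

theorem inner_orthonormalBasis (g : RiemannianMetric E M) (x : M)
    (i j : Fin (Module.finrank ℝ E)) :
    g.inner x (orthonormalBasis g x i) (orthonormalBasis g x j) = if i = j then 1 else 0 :=
  (exists_orthonormal_basis g x).choose_spec i j

theorem sum_inner_smul_orthonormalBasis (g : RiemannianMetric E M) (x : M)
    (v : TangentSpace 𝓘(ℝ, E) x) :
    ∑ i, g.inner x v (orthonormalBasis g x i) • orthonormalBasis g x i = v := by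
  have h (i) : g.inner x v (orthonormalBasis g x i) = (orthonormalBasis g x).repr v i := by
    have h := congrArg (fun u ↦ g.inner x u (orthonormalBasis g x i))
      ((orthonormalBasis g x).sum_repr v)
    simpa [inner_orthonormalBasis, -Module.Basis.sum_repr] using h.symm
  simp only [h, Module.Basis.sum_repr]

open Classical in
/-- The covariant derivative `v ↦ ∇_v Y` at `x` of the Levi-Civita connection, for a field `Y`
that is differentiable at `x` (with the value `0` otherwise): `∇_v Y = ∑ i, g(∇_v Y, eᵢ) eᵢ`, where
`2 g(∇_v Y, eᵢ)` is given by the Koszul formula. -/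
def nabla (g : RiemannianMetric E M) (Y : TangentField E M) (x : M) :
    TangentSpace 𝓘(ℝ, E) x →L[ℝ] TangentSpace 𝓘(ℝ, E) x :=
  if hY : MDiffAt (T% Y) x then
    (1 / 2 : ℝ) • ∑ i, (TensorialAt.mkHom (koszul g · Y (extend E (orthonormalBasis g x i)) x) x
      (koszul_tensorial_left g hY (mdifferentiableAt_extend ..))).smulRight
        (orthonormalBasis g x i)
  else 0

theorem two_mul_inner_nabla (g : RiemannianMetric E M) {X Y Z : TangentField E M} {x : M}
    (hX : MDiffAt (T% X) x) (hY : MDiffAt (T% Y) x) (hZ : MDiffAt (T% Z) x) :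
    2 * g.inner x (nabla g Y x (X x)) (Z x) = koszul g X Y Z x := by
  let L := TensorialAt.mkHom (koszul g X Y · x) x (koszul_tensorial_right g hX hY)
  have hL : L (Z x) = koszul g X Y Z x := TensorialAt.mkHom_apply _ hZ
  have key (i) : 2 * g.inner x (nabla g Y x (X x)) (orthonormalBasis g x i) =
      L (orthonormalBasis g x i) := by
    have hn (j) : TensorialAt.mkHom (koszul g · Y (extend E (orthonormalBasis g x j)) x) x
        (koszul_tensorial_left g hY (mdifferentiableAt_extend ..)) (X x) =
        koszul g X Y (extend E (orthonormalBasis g x j)) x := TensorialAt.mkHom_apply _ hX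
    have hi : L (orthonormalBasis g x i) =
        koszul g X Y (extend E (orthonormalBasis g x i)) x := rfl
    simp [nabla, hY, hn, inner_orthonormalBasis, hi]
  rw [← hL, ← sum_inner_smul_orthonormalBasis g x (Z x)]
  simp only [map_sum, map_smul, smul_eq_mul, Finset.mul_sum, ← key]
  exact Finset.sum_congr rfl fun i _ ↦ by ring

theorem inner_ext (g : RiemannianMetric E M) {x : M} {v w : TangentSpace 𝓘(ℝ, E) x}
    (h : ∀ u, g.inner x v u = g.inner x w u) : v = w := by
  rw [← sum_inner_smul_orthonormalBasis g x v, ← sum_inner_smul_orthonormalBasis g x w]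
  simp [h]

/-- The Levi-Civita connection of `g`. -/
def leviCivita (g : RiemannianMetric E M) :
    CovariantDerivative 𝓘(ℝ, E) E (fun x : M ↦ TangentSpace 𝓘(ℝ, E) x) where
  toFun := nabla g
  isCovariantDerivativeOnUniv :=
    { add := fun {Y Y' x} hY hY' _ ↦ by
        ext v
        refine inner_ext g fun w ↦ ?_
        have hv := mdifferentiableAt_extend 𝓘(ℝ, E) E v
        have hw := mdifferentiableAt_extend 𝓘(ℝ, E) E w
        have h1 := two_mul_inner_nabla g hv (mdifferentiableAt_add_section hY hY') hw
        have h2 := two_mul_inner_nabla g hv hY hw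
        have h3 := two_mul_inner_nabla g hv hY' hw
        have h4 := koszul_add_middle g hv hY hY' hw
        simp only [extend_apply_self] at h1 h2 h3
        simp only [add_apply, map_add]
        change 2 * g.inner x (nabla g (Y + Y') x v) w = _ at h1
        linarith
      leibniz := fun {Y f x} hY hf _ ↦ by
        ext v
        refine inner_ext g fun w ↦ ?_
        have hv := mdifferentiableAt_extend 𝓘(ℝ, E) E v
        have hw := mdifferentiableAt_extend 𝓘(ℝ, E) E w
        have h1 := two_mul_inner_nabla g hv (hf.smul_section hY) hw
        have h2 := two_mul_inner_nabla g hv hY hw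
        have h4 := koszul_smul_middle g hv hf hY hw
        simp only [extend_apply_self] at h1 h2 h4
        simp only [add_apply, smul_apply,
          ContinuousLinearMap.smulRight_apply, map_add, map_smul, smul_eq_mul]
        change 2 * g.inner x (nabla g (f • Y) x v) w = _ at h1
        linear_combination (1 / 2) * h1 + (1 / 2) * h4 - (f x / 2) * h2 }

/-- The Levi-Civita connection is torsion-free. -/
theorem leviCivita_torsion (g : RiemannianMetric E M) : (leviCivita g).torsion = 0 := by
  rw [CovariantDerivative.torsion_eq_zero_iff]
  intro X Y x hX hY
  refine inner_ext g fun w ↦ ?_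
  have hw := mdifferentiableAt_extend 𝓘(ℝ, E) E w
  have h1 := two_mul_inner_nabla g hX hY hw
  have h2 := two_mul_inner_nabla g hY hX hw
  have h3 := koszul_sub_swap g X Y (extend E w) x
  simp only [extend_apply_self] at h1 h2 h3
  change g.inner x (nabla g Y x (X x) - nabla g X x (Y x)) w = _
  simp only [map_sub, sub_apply]
  linarith

/-- The Levi-Civita connection is compatible with the metric:
`X g(Y, Z) = g(∇_X Y, Z) + g(Y, ∇_X Z)`. -/
theorem leviCivita_metric (g : RiemannianMetric E M) {Y Z : TangentField E M} {x : M}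
    (hY : MDiffAt (T% Y) x) (hZ : MDiffAt (T% Z) x) (v : TangentSpace 𝓘(ℝ, E) x) :
    d% (fun y ↦ g.inner y (Y y) (Z y)) x v =
      g.inner x (leviCivita g Y x v) (Z x) + g.inner x (Y x) (leviCivita g Z x v) := by
  have hv := mdifferentiableAt_extend 𝓘(ℝ, E) E v
  have h1 := two_mul_inner_nabla g hv hY hZ
  have h2 := two_mul_inner_nabla g hv hZ hY
  have h3 := koszul_add_swap g (extend E v) Y Z x
  simp only [extend_apply_self] at h1 h2 h3
  change _ = g.inner x (nabla g Y x v) (Z x) + g.inner x (Y x) (nabla g Z x v)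
  rw [g.symm x (Y x)]
  linarith

/-- The curvature `R(X, Y) Z = ∇_X ∇_Y Z - ∇_Y ∇_X Z - ∇_[X, Y] Z`, at the point `x`. -/
def curvature (g : RiemannianMetric E M) (X Y Z : TangentField E M) (x : M) :
    TangentSpace 𝓘(ℝ, E) x :=
  leviCivita g (fun y ↦ leviCivita g Z y (Y y)) x (X x)
    - leviCivita g (fun y ↦ leviCivita g Z y (X y)) x (Y x)
    - leviCivita g Z x (mlieBracket 𝓘(ℝ, E) X Y x)

/-- The curvature tensor `R(u, v) w` on tangent vectors at `x`: the vectors are extended to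
vector fields that are smooth near `x` (constant in a local trivialization of the tangent
bundle); by tensoriality the choice of the extensions is immaterial. -/
def curvatureAt (g : RiemannianMetric E M) (x : M) (u v w : TangentSpace 𝓘(ℝ, E) x) :
    TangentSpace 𝓘(ℝ, E) x :=
  curvature g (extend E u) (extend E v) (extend E w) x

/-- The Ricci tensor `Ric(v, w) = ∑ i, g(R(eᵢ, v) w, eᵢ)`, i.e. the trace of `u ↦ R(u, v) w`. -/
def ricci (g : RiemannianMetric E M) (x : M) (v w : TangentSpace 𝓘(ℝ, E) x) : ℝ :=
  ∑ i, g.inner x (curvatureAt g x (orthonormalBasis g x i) v w) (orthonormalBasis g x i)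

/-- The Ricci operator `Ric♯`, given by `g(Ric♯ v, w) = Ric(v, w)`, i.e.
`Ric♯ v = ∑ j, Ric(v, eⱼ) eⱼ` in an orthonormal basis. -/
def ricciOperator (g : RiemannianMetric E M) (x : M) (v : TangentSpace 𝓘(ℝ, E) x) :
    TangentSpace 𝓘(ℝ, E) x :=
  ∑ j, ricci g x v (orthonormalBasis g x j) • orthonormalBasis g x j

end CoKahler

end

/-!
The point is that `φ` is parallel for the Levi-Civita connection; the rest is the algebra of
curvature tensors.

*`φ` and `ξ` are parallel.* Evaluated on fields pulled back from `M`, the vanishing of the torsion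
of `J` on `M × ℝ` together with `dη = 0` gives `[φ, φ] = 0` (`IsNormal.nijenhuis_φ`). Since `∇` is
metric and torsion-free, the equations `dη = 0`, `dΦ = 0` and `[φ, φ] = 0` become algebraic
identities between `h = ∇ξ` and `A = ∇φ` at each point. With one argument equal to `ξ`, the last two
compute `φ (∇_ξ φ)` as `h + φ h φ` and as `h - φ h φ`, so `φ h φ = 0`, and then `h = 0`. What
remains is the classical argument for Kähler manifolds, and it gives `A = 0`
(`LinearAlmostContact.eq_zero_of_closed_of_normal`).

*Curvature.* As `φ` is parallel, `R(u, v) φ = φ R(u, v)`. By the pair symmetry of the curvature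
tensor, a consequence of the Bianchi identity, this yields `R(φ u, v) = -R(u, φ v)`
(`LinearAlmostContact.curvature_φ_left`). Put `L u = R(u, v) w`. Then
`Ric(φ v, w) = -tr (L ∘ φ) = -tr (φ ∘ L) = -Ric(v, φ w)` (`IsCoKahler.ricci_φ_left`). Because `φ` is
skew for `g`, this is the statement that `Ric♯` commutes with `φ`.

*Foundations.* The symmetries of the curvature need three facts about smooth fields. The bracket
acts on functions as a commutator (`mvfderiv_mlieBracket`), which is extracted from the Jacobi
identity. The field `∇_Y Z` is smooth (`contMDiffAt_leviCivita`), which follows from the Koszul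
formula and Cramer's rule for the Gram matrix of a local frame. The curvature is a tensor
(`curvature_eq_curvatureAt`).
-/

noncomputable section
namespace CoKahler

open scoped Topology

/-! ### Brackets of smooth fields and tensoriality -/

section General

variable {F : Type*} [NormedAddCommGroup F] [NormedSpace ℝ F] {H : Type*} [TopologicalSpace H]
  {I : ModelWithCorners ℝ F H} {N : Type*} [TopologicalSpace N] [ChartedSpace H N]
  [IsManifold I ∞ N]

theorem contMDiffAt_mvfderiv_apply {f : N → ℝ} {X : ∀ p : N, TangentSpace I p} {x : N}
    (hf : CMDiffAt ∞ f x) (hX : CMDiffAt ∞ (T% X) x) :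
    CMDiffAt ∞ (fun y ↦ d% f y (X y)) x := by
  have h1 := hf.mfderiv_const (m := ∞) (by simp)
  have h2 : CMDiffAt ∞ (fun y ↦ (⟨f y, mfderiv I 𝓘(ℝ, ℝ) f y (X y)⟩ : TangentBundle 𝓘(ℝ, ℝ) ℝ)) x :=
    ContMDiffAt.clm_apply_of_inCoordinates (ϕ := fun y ↦ mfderiv I 𝓘(ℝ, ℝ) f y) h1 hX hf
  exact (contMDiff_snd_tangentBundle_modelSpace ℝ 𝓘(ℝ, ℝ) (n := ∞)).contMDiffAt.comp x h2

theorem eventually_mdifferentiableAt_section {X : ∀ p : N, TangentSpace I p} {x : N}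
    (hX : CMDiffAt ∞ (T% X) x) : ∀ᶠ y in 𝓝 x, MDiffAt (T% X) y := by
  have := (contMDiffAt_iff_contMDiffAt_nhds (n := 1) (by simp)).1 (hX.of_le (by simp))
  exact this.mono fun y hy ↦ hy.mdifferentiableAt (by simp)

theorem eventually_mdifferentiableAt {f : N → ℝ} {x : N}
    (hf : CMDiffAt ∞ f x) : ∀ᶠ y in 𝓝 x, MDiffAt f y := by
  have := (contMDiffAt_iff_contMDiffAt_nhds (n := 1) (by simp)).1 (hf.of_le (by simp))
  exact this.mono fun y hy ↦ hy.mdifferentiableAt (by simp)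

variable [FiniteDimensional ℝ F]

theorem two_le_infty : (2 : ℕ∞ω) ≤ ∞ :=
  WithTop.coe_le_coe.2 (le_top : (2 : ℕ∞) ≤ ⊤)

theorem three_le_infty : (3 : ℕ∞ω) ≤ ∞ :=
  WithTop.coe_le_coe.2 (le_top : (3 : ℕ∞) ≤ ⊤)

theorem contMDiffAt_mlieBracket {X Y : ∀ p : N, TangentSpace I p} {x : N}
    (hX : CMDiffAt ∞ (T% X) x) (hY : CMDiffAt ∞ (T% Y) x) :
    CMDiffAt ∞ (T% (mlieBracket I X Y)) x := by
  have : CompleteSpace F := FiniteDimensional.complete ℝ F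
  have : IsManifold I ((⊤ : ℕ∞) + 1) N := by simpa using ‹IsManifold I ∞ N›
  have : IsManifold I (minSmoothness ℝ 2) N := by
    simpa using IsManifold.of_le (I := I) (M := N) two_le_infty
  exact ContMDiffAt.mlieBracket_vectorField (m := ⊤) (n := ⊤) hX hY (by simp)

theorem jacobi_mlieBracket {X Y Z : ∀ p : N, TangentSpace I p} {x : N}
    (hX : CMDiffAt ∞ (T% X) x) (hY : CMDiffAt ∞ (T% Y) x) (hZ : CMDiffAt ∞ (T% Z) x) :
    mlieBracket I X (mlieBracket I Y Z) x =
      mlieBracket I (mlieBracket I X Y) Z x + mlieBracket I Y (mlieBracket I X Z) x := by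
  have : CompleteSpace F := FiniteDimensional.complete ℝ F
  have : IsManifold I (minSmoothness ℝ 3) N := by
    simpa using IsManifold.of_le (I := I) (M := N) three_le_infty
  have h2 : minSmoothness ℝ 2 ≤ ∞ := by simpa using two_le_infty
  exact leibniz_identity_mlieBracket_apply (hX.of_le h2) (hY.of_le h2) (hZ.of_le h2)

/-- A vector field acts on functions as a derivation, and the bracket acts as the commutator. This
is read off from the Jacobi identity for `X`, `Y` and `f • Z`. -/
theorem mvfderiv_mlieBracket {X Y : ∀ p : N, TangentSpace I p} {f : N → ℝ} {x : N}
    (hX : CMDiffAt ∞ (T% X) x) (hY : CMDiffAt ∞ (T% Y) x) (hf : CMDiffAt ∞ f x) :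
    d% f x (mlieBracket I X Y x) =
      d% (fun y ↦ d% f y (Y y)) x (X x) - d% (fun y ↦ d% f y (X y)) x (Y x) := by
  have hn : (∞ : ℕ∞ω) ≠ 0 := by simp
  have hXd := hX.mdifferentiableAt hn
  have hYd := hY.mdifferentiableAt hn
  have hfd := hf.mdifferentiableAt hn
  -- The Jacobi identity gives the claim multiplied by a tangent vector, which must be nonzero.
  by_cases hF : Subsingleton F
  · have h (v w : TangentSpace I x) : v = w := hF.elim (α := F) v w
    rw [h (mlieBracket I X Y x) 0, h (X x) 0, h (Y x) 0]
    simp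
  have : Nontrivial F := not_subsingleton_iff_nontrivial.1 hF
  obtain ⟨w, hw⟩ : ∃ w : TangentSpace I x, w ≠ 0 := exists_ne (α := F) 0
  let Z := extend F w
  have hZ : CMDiffAt ∞ (T% Z) x := contMDiffAt_extend I F w
  have hZx : Z x = w := extend_apply_self ..
  have hZd := hZ.mdifferentiableAt hn
  have key {V : ∀ p : N, TangentSpace I p} (hV : CMDiffAt ∞ (T% V) x) :
      ∀ᶠ y in 𝓝 x, mlieBracket I V (f • Z) y =
        ((fun y ↦ d% f y (V y)) • Z + f • mlieBracket I V Z) y := by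
    filter_upwards [eventually_mdifferentiableAt hf, eventually_mdifferentiableAt_section hZ]
      with y h1 h2
    simpa using mlieBracket_smul_right (V := V) h1 h2
  have J1 := jacobi_mlieBracket hX hY (hf.smul_section hZ)
  have J2 := jacobi_mlieBracket hX hY hZ
  have hXf := contMDiffAt_mvfderiv_apply hf hX
  have hYf := contMDiffAt_mvfderiv_apply hf hY
  have hXZ := contMDiffAt_mlieBracket hX hZ
  have hYZ := contMDiffAt_mlieBracket hY hZ
  have expand {V : ∀ p : N, TangentSpace I p} {k : N → ℝ} {W : ∀ p : N, TangentSpace I p}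
      (hk : CMDiffAt ∞ k x) (hW : CMDiffAt ∞ (T% W) x) :
      mlieBracket I V (k • Z + f • W) x = d% k x (V x) • Z x + k x • mlieBracket I V Z x +
        (d% f x (V x) • W x + f x • mlieBracket I V W x) := by
    rw [mlieBracket_add_right ((hk.smul_section hZ).mdifferentiableAt hn)
      ((hf.smul_section hW).mdifferentiableAt hn),
      mlieBracket_smul_right (hk.mdifferentiableAt hn) hZd,
      mlieBracket_smul_right hfd (hW.mdifferentiableAt hn)]
  rw [(Filter.EventuallyEq.refl _ X).mlieBracket_vectorField_eq (key hY),
    (Filter.EventuallyEq.refl _ Y).mlieBracket_vectorField_eq (key hX),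
    expand hYf hYZ, expand hXf hXZ, mlieBracket_smul_right hfd hZd, J2] at J1
  rw [hZx] at J1
  have : (d% (fun y ↦ d% f y (Y y)) x (X x) - d% (fun y ↦ d% f y (X y)) x (Y x)
      - d% f x (mlieBracket I X Y x)) • w = 0 := by
    rw [← sub_eq_zero] at J1
    rw [← J1]
    module
  have := (smul_eq_zero.1 this).resolve_right hw
  linarith

/-- An operation that is additive and linear over smooth functions depends on a smooth field only
through its value at the point. -/
theorem eq_of_smooth_tensorial {A : Type*} [AddCommGroup A] [Module ℝ A]
    {Φ : (∀ p : N, TangentSpace I p) → A} {x : N}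
    (hcongr : ∀ {V W : ∀ p : N, TangentSpace I p}, CMDiffAt ∞ (T% V) x → CMDiffAt ∞ (T% W) x →
      (∀ᶠ y in 𝓝 x, V y = W y) → Φ V = Φ W)
    (hadd : ∀ {V W : ∀ p : N, TangentSpace I p}, CMDiffAt ∞ (T% V) x → CMDiffAt ∞ (T% W) x →
      Φ (V + W) = Φ V + Φ W)
    (hsmul : ∀ {f : N → ℝ} {V : ∀ p : N, TangentSpace I p}, CMDiffAt ∞ f x →
      CMDiffAt ∞ (T% V) x → Φ (f • V) = f x • Φ V)
    {V W : ∀ p : N, TangentSpace I p} (hV : CMDiffAt ∞ (T% V) x) (hW : CMDiffAt ∞ (T% W) x)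
    (hVW : V x = W x) : Φ V = Φ W := by
  let t := trivializationAt F (TangentSpace I (M := N)) x
  have hx : x ∈ t.baseSet := FiberBundle.mem_baseSet_trivializationAt F _ x
  let b := Module.finBasis ℝ F
  let s := t.localFrame b
  let c := t.localFrameCoeff I b
  have hs (i) : CMDiffAt ∞ (T% (s i)) x := contMDiffAt_localFrame_of_mem ∞ _ b i hx
  have hz : Φ 0 = 0 := by
    have h := hadd (V := 0) (W := 0) (contMDiff_zeroSection ℝ (TangentSpace I (M := N)) x)
      (contMDiff_zeroSection ℝ (TangentSpace I (M := N)) x)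
    rwa [add_zero, left_eq_add] at h
  have hsum (σ : Fin (Module.finrank ℝ F) → ∀ p : N, TangentSpace I p)
      (hσ : ∀ i, CMDiffAt ∞ (T% (σ i)) x) (S : Finset (Fin (Module.finrank ℝ F))) :
      Φ (∑ i ∈ S, σ i) = ∑ i ∈ S, Φ (σ i) ∧ CMDiffAt ∞ (T% (∑ i ∈ S, σ i)) x := by
    classical
    induction S using Finset.induction_on with
    | empty =>
      exact ⟨by simpa using hz,
        by simpa using! contMDiff_zeroSection ℝ (TangentSpace I (M := N)) x⟩
    | insert a S ha ih =>
      rw [Finset.sum_insert ha, Finset.sum_insert ha]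
      exact ⟨by rw [hadd (hσ a) ih.2, ih.1], (hσ a).add_section ih.2⟩
  have expand {V : ∀ p : N, TangentSpace I p} (hV : CMDiffAt ∞ (T% V) x) :
      Φ V = ∑ i, c i x (V x) • Φ (s i) := by
    have hc (i) : CMDiffAt ∞ (LinearMap.piApply (c i) V) x :=
      contMDiffAt_localFrameCoeff b hx hV i
    have h := hsum (fun i ↦ (LinearMap.piApply (c i) V) • s i)
      (fun i ↦ (hc i).smul_section (hs i)) Finset.univ
    rw [hcongr hV h.2, h.1]
    · exact Finset.sum_congr rfl fun i _ ↦ hsmul (hc i) (hs i)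
    · exact (t.eventually_eq_localFrame_sum_coeff_smul b hx).mono fun y hy ↦ by
        simpa using hy
  rw [expand hV, expand hW, hVW]

end General

variable {E : Type*} [NormedAddCommGroup E] [NormedSpace ℝ E]
  {M : Type*} [TopologicalSpace M] [ChartedSpace E M] [IsManifold 𝓘(ℝ, E) ∞ M]

/-! ### Fields on `M × ℝ` -/

/-- The field `X + a d/dt` on `M × ℝ`, for a field `X` and a function `a` on `M`. -/
def prodField (X : TangentField E M) (a : M → ℝ) (q : M × ℝ) :
    TangentSpace (𝓘(ℝ, E).prod 𝓘(ℝ, ℝ)) q :=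
  Prod.mk (α := E) (β := ℝ) (X q.1) (a q.1)

theorem contMDiffAt_prodField {X : TangentField E M} {a : M → ℝ} {p : M × ℝ}
    (hX : CMDiffAt ∞ (T% X) p.1) (ha : CMDiffAt ∞ a p.1) :
    CMDiffAt ∞ (T% (prodField X a)) p := by
  have hp : CMDiffAt ∞ (Prod.fst : M × ℝ → M) p := contMDiffAt_fst
  have h1 : CMDiffAt ∞ (fun q : M × ℝ ↦ (⟨q.1, X q.1⟩ : TangentBundle 𝓘(ℝ, E) M)) p :=
    ContMDiffAt.comp p hX hp
  have h2 : CMDiffAt ∞ (fun q : M × ℝ ↦ (⟨q.2, a q.1⟩ : TangentBundle 𝓘(ℝ, ℝ) ℝ)) p := by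
    rw [contMDiffAt_totalSpace]
    refine ⟨contMDiffAt_snd, ?_⟩
    simpa using! ContMDiffAt.comp p ha hp
  exact (contMDiff_equivTangentBundleProd_symm (I := 𝓘(ℝ, E)) (M := M) (I' := 𝓘(ℝ, ℝ)) (M' := ℝ)
    (n := ∞)).contMDiffAt.comp p (h1.prodMk h2)

omit [IsManifold 𝓘(ℝ, E) ∞ M] in
theorem mvfderiv_comp_fst {h : M → ℝ} {q : M × ℝ} (hh : MDiffAt h q.1)
    (w : TangentSpace (𝓘(ℝ, E).prod 𝓘(ℝ, ℝ)) q) :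
    d% (fun q : M × ℝ ↦ h q.1) q w = d% h q.1 (Prod.fst (α := E) (β := ℝ) w) := by
  have := mvfderiv_comp_apply (g := h) (f := (Prod.fst : M × ℝ → M)) (I' := 𝓘(ℝ, E).prod 𝓘(ℝ, ℝ))
    (I := 𝓘(ℝ, E)) q hh mdifferentiableAt_fst w
  rw [mfderiv_fst] at this
  exact this

omit [IsManifold 𝓘(ℝ, E) ∞ M] in
theorem mvfderiv_snd {q : M × ℝ} (w : TangentSpace (𝓘(ℝ, E).prod 𝓘(ℝ, ℝ)) q) :
    d% (fun q : M × ℝ ↦ q.2) q w = Prod.snd (α := E) (β := ℝ) w := by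
  have : mfderiv (𝓘(ℝ, E).prod 𝓘(ℝ, ℝ)) 𝓘(ℝ, ℝ) (fun q : M × ℝ ↦ q.2) q = _ := mfderiv_snd
  rw [mvfderiv, this]
  rfl

/-- Smooth functions separate tangent vectors. -/
theorem eq_of_forall_mvfderiv_eq {x : M} {v w : TangentSpace 𝓘(ℝ, E) x}
    (h : ∀ f : M → ℝ, CMDiffAt ∞ f x → d% f x v = d% f x w) : v = w := by
  have hinj : Function.Injective (mfderiv 𝓘(ℝ, E) 𝓘(ℝ, E) (extChartAt 𝓘(ℝ, E) x) x) :=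
    (isInvertible_mfderiv_extChartAt (mem_extChartAt_source x)).injective
  apply hinj
  refine (SeparatingDual.eq_iff_forall_dual_eq (R := ℝ) (V := E)).2 fun l ↦ ?_
  have hc : CMDiffAt ∞ (extChartAt 𝓘(ℝ, E) x) x := contMDiffAt_extChartAt
  have hl : CMDiffAt ∞ (fun y ↦ l (extChartAt 𝓘(ℝ, E) x y)) x :=
    l.contMDiff.contMDiffAt.comp x hc
  have hd (u : TangentSpace 𝓘(ℝ, E) x) : d% (fun y ↦ l (extChartAt 𝓘(ℝ, E) x y)) x u =
      l (mfderiv 𝓘(ℝ, E) 𝓘(ℝ, E) (extChartAt 𝓘(ℝ, E) x) x u) := by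
    have := mvfderiv_comp_apply (g := l) (f := extChartAt 𝓘(ℝ, E) x) (I := 𝓘(ℝ, E))
      (I' := 𝓘(ℝ, E)) x l.mdifferentiableAt (hc.mdifferentiableAt (by simp)) u
    simpa [mvfderiv, Function.comp_def] using! this
  have := h _ hl
  rwa [hd, hd] at this

/-! ### Smoothness of tensors applied to fields -/

namespace AlmostContactStructure

variable (S : AlmostContactStructure E M)

theorem contMDiffAt_φ_apply {X : TangentField E M} {x : M} (hX : CMDiffAt ∞ (T% X) x) :
    CMDiffAt ∞ (T% (fun y ↦ S.φ y (X y))) x :=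
  ContMDiffAt.clm_bundle_apply S.contMDiff_φ.contMDiffAt hX

theorem contMDiffAt_η_apply {X : TangentField E M} {x : M} (hX : CMDiffAt ∞ (T% X) x) :
    CMDiffAt ∞ (fun y ↦ S.η y (X y)) x := by
  have : ContMDiffAt 𝓘(ℝ, E) (𝓘(ℝ, E).prod 𝓘(ℝ)) ∞
      (fun m ↦ TotalSpace.mk' ℝ (E := Bundle.Trivial M ℝ) m (S.η m (X m))) x :=
    ContMDiffAt.clm_bundle_apply (F₁ := E) (F₂ := ℝ) S.contMDiff_η.contMDiffAt hX
  simp only [contMDiffAt_totalSpace] at this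
  exact this.2

theorem mdifferentiableAt_φ_apply {X : TangentField E M} {x : M} (hX : MDiffAt (T% X) x) :
    MDiffAt (T% (fun y ↦ S.φ y (X y))) x :=
  MDifferentiableAt.clm_bundle_apply (S.contMDiff_φ.contMDiffAt.mdifferentiableAt (by simp)) hX

theorem mdifferentiableAt_ξ {x : M} : MDiffAt (T% S.ξ) x :=
  S.contMDiff_ξ.contMDiffAt.mdifferentiableAt (by simp)

end AlmostContactStructure

/-- The metric at `x`, as a bilinear form. -/
def innerₗ (g : RiemannianMetric E M) (x : M) :
    TangentSpace 𝓘(ℝ, E) x →ₗ[ℝ] TangentSpace 𝓘(ℝ, E) x →ₗ[ℝ] ℝ :=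
  LinearMap.mk₂ ℝ (fun v w ↦ g.inner x v w) (by simp) (by simp) (by simp) (by simp)

@[simp] theorem innerₗ_apply (g : RiemannianMetric E M) (x : M) (v w : TangentSpace 𝓘(ℝ, E) x) :
    innerₗ g x v w = g.inner x v w := rfl

theorem contMDiffAt_extend_infty {x : M} (v : TangentSpace 𝓘(ℝ, E) x) :
    CMDiffAt ∞ (T% (extend E v)) x :=
  contMDiffAt_extend 𝓘(ℝ, E) E v

theorem contMDiffAt_inner (g : RiemannianMetric E M) {X Y : TangentField E M} {x : M}
    (hX : CMDiffAt ∞ (T% X) x) (hY : CMDiffAt ∞ (T% Y) x) :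
    CMDiffAt ∞ (fun y ↦ g.inner y (X y) (Y y)) x := by
  have : ContMDiffAt 𝓘(ℝ, E) (𝓘(ℝ, E).prod 𝓘(ℝ)) ∞
      (fun m ↦ TotalSpace.mk' ℝ (E := Bundle.Trivial M ℝ) m (g.inner m (X m) (Y m))) x := by
    apply ContMDiffAt.clm_bundle_apply₂ (F₁ := E) (F₂ := E)
    · exact g.contMDiff.contMDiffAt
    · exact hX
    · exact hY
  simp only [contMDiffAt_totalSpace] at this
  exact this.2

omit [IsManifold 𝓘(ℝ, E) ∞ M] in
theorem contMDiffAt_det {ι : Type*} [Fintype ι] [DecidableEq ι] {G : M → Matrix ι ι ℝ} {x : M}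
    (hG : ∀ i j, CMDiffAt ∞ (fun y ↦ G y i j) x) : CMDiffAt ∞ (fun y ↦ (G y).det) x := by
  simp only [Matrix.det_apply]
  refine contMDiffAt_finsetSum fun σ _ ↦ ?_
  simp only [Units.smul_def, zsmul_eq_mul]
  exact contMDiffAt_const.mul (contMDiffAt_finsetProd fun i _ ↦ hG _ _)

variable [FiniteDimensional ℝ E]

/-! ### Normality -/

/-- `[X + a d/dt, Y + b d/dt] = [X, Y] + (X b - Y a) d/dt`. Both sides are compared through their
actions on the functions on `M` and on the function `t`, where the bracket is a commutator. -/
theorem mlieBracket_prodField {X Y : TangentField E M} {a b : M → ℝ} {p : M × ℝ}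
    (hX : CMDiffAt ∞ (T% X) p.1) (hY : CMDiffAt ∞ (T% Y) p.1)
    (ha : CMDiffAt ∞ a p.1) (hb : CMDiffAt ∞ b p.1) :
    mlieBracket (𝓘(ℝ, E).prod 𝓘(ℝ, ℝ)) (prodField X a) (prodField Y b) p =
      Prod.mk (α := E) (β := ℝ) (mlieBracket 𝓘(ℝ, E) X Y p.1)
        (d% b p.1 (X p.1) - d% a p.1 (Y p.1)) := by
  have hP := contMDiffAt_prodField hX ha
  have hQ := contMDiffAt_prodField hY hb
  have hn : (∞ : ℕ∞ω) ≠ 0 := by simp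
  refine Prod.ext ?_ ?_
  · refine eq_of_forall_mvfderiv_eq (E := E) (M := M) (x := p.1) fun h hh ↦ ?_
    have hh' : CMDiffAt ∞ (fun q : M × ℝ ↦ h q.1) p := ContMDiffAt.comp p hh contMDiffAt_fst
    have key {V : TangentField E M} {c : M → ℝ} : (fun q : M × ℝ ↦
        d% (fun q : M × ℝ ↦ h q.1) q (prodField V c q)) =ᶠ[𝓝 p] fun q ↦ d% h q.1 (V q.1) := by
      have : ∀ᶠ q : M × ℝ in 𝓝 p, MDiffAt h q.1 :=
        continuousAt_fst.eventually (eventually_mdifferentiableAt hh)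
      exact this.mono fun q hq ↦ mvfderiv_comp_fst hq _
    have key' {V W : TangentField E M} {c c' : M → ℝ} (hV : CMDiffAt ∞ (T% V) p.1) :
        d% (fun q : M × ℝ ↦ d% (fun q : M × ℝ ↦ h q.1) q (prodField V c q)) p
          (prodField W c' p) = d% (fun y ↦ d% h y (V y)) p.1 (W p.1) := by
      rw [mvfderiv, key.mfderiv_eq]
      exact mvfderiv_comp_fst (h := fun y ↦ d% h y (V y))
        ((contMDiffAt_mvfderiv_apply hh hV).mdifferentiableAt hn) _
    have := mvfderiv_mlieBracket hP hQ hh'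
    rw [key' hY, key' hX, ← mvfderiv_mlieBracket hX hY hh,
      mvfderiv_comp_fst (hh.mdifferentiableAt hn)] at this
    exact this
  · have h := mvfderiv_mlieBracket hP hQ (f := fun q : M × ℝ ↦ q.2) contMDiffAt_snd
    simp only [mvfderiv_snd] at h
    have e1 := mvfderiv_comp_fst (q := p) (hb.mdifferentiableAt hn) (prodField X a p)
    have e2 := mvfderiv_comp_fst (q := p) (ha.mdifferentiableAt hn) (prodField Y b p)
    exact h.trans (congrArg₂ (· - ·) e1 e2)

namespace AlmostContactStructure

variable {S : AlmostContactStructure E M}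

/-- Normality together with `dη = 0` makes the Nijenhuis torsion of `φ` vanish: this is the
`M`-component of the torsion of `J` on fields pulled back from `M`. -/
theorem IsNormal.nijenhuis_φ (hN : S.IsNormal) (hη : IsClosedOneForm (fun x v ↦ S.η x v))
    {X Y : TangentField E M} {x : M} (hX : CMDiffAt ∞ (T% X) x) (hY : CMDiffAt ∞ (T% Y) x) :
    nijenhuis 𝓘(ℝ, E) (fun y v ↦ S.φ y v) X Y x = 0 := by
  have h0 : CMDiffAt ∞ (fun _ : M ↦ (0 : ℝ)) x := contMDiffAt_const
  have hJ (V : TangentField E M) : (fun q ↦ S.productJ q (prodField V (fun _ ↦ 0) q)) =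
      prodField (fun y ↦ S.φ y (V y)) (fun y ↦ S.η y (V y)) := by
    funext q
    have h1 : S.φ q.1 (V q.1) - (0 : ℝ) • S.ξ q.1 = S.φ q.1 (V q.1) := by simp
    exact Prod.ext (α := E) (β := ℝ) h1 rfl
  have hφX := S.contMDiffAt_φ_apply hX
  have hφY := S.contMDiffAt_φ_apply hY
  have hηX := S.contMDiffAt_η_apply hX
  have hηY := S.contMDiffAt_η_apply hY
  have h := hN (x, 0) _ _ (contMDiffAt_prodField (p := (x, 0)) hX h0)
    (contMDiffAt_prodField (p := (x, 0)) hY h0)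
  rw [nijenhuis, hJ, hJ, mlieBracket_prodField (p := (x, 0)) hX hY h0 h0,
    mlieBracket_prodField (p := (x, 0)) hφX hφY hηX hηY,
    mlieBracket_prodField (p := (x, 0)) hφX hY hηX h0,
    mlieBracket_prodField (p := (x, 0)) hX hφY h0 hηY] at h
  have h1 : S.φ x (S.φ x (mlieBracket 𝓘(ℝ, E) X Y x) -
        (d% (fun _ : M ↦ (0 : ℝ)) x (X x) - d% (fun _ : M ↦ (0 : ℝ)) x (Y x)) • S.ξ x)
        - S.η x (mlieBracket 𝓘(ℝ, E) X Y x) • S.ξ x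
      + mlieBracket 𝓘(ℝ, E) (fun y ↦ S.φ y (X y)) (fun y ↦ S.φ y (Y y)) x
      - (S.φ x (mlieBracket 𝓘(ℝ, E) (fun y ↦ S.φ y (X y)) Y x)
        - (d% (fun _ : M ↦ (0 : ℝ)) x (S.φ x (X x)) - d% (fun y ↦ S.η y (X y)) x (Y x)) • S.ξ x)
      - (S.φ x (mlieBracket 𝓘(ℝ, E) X (fun y ↦ S.φ y (Y y)) x)
        - (d% (fun y ↦ S.η y (Y y)) x (X x) - d% (fun _ : M ↦ (0 : ℝ)) x (S.φ x (Y x))) • S.ξ x)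
      = 0 := congrArg (Prod.fst (α := E) (β := ℝ)) h
  have hc : d% (fun y ↦ S.η y (Y y)) x (X x) - d% (fun y ↦ S.η y (X y)) x (Y x) =
      S.η x (mlieBracket 𝓘(ℝ, E) X Y x) := sub_eq_zero.1 (hη x X Y hX hY)
  rw [nijenhuis, ← h1, ← hc]
  simp only [mvfderiv_const, zero_apply, sub_self, zero_smul, sub_zero, zero_sub]
  module

end AlmostContactStructure

/-! ### Smoothness of the Levi-Civita connection -/

theorem contMDiffAt_koszul (g : RiemannianMetric E M) {X Y Z : TangentField E M} {x : M}
    (hX : CMDiffAt ∞ (T% X) x) (hY : CMDiffAt ∞ (T% Y) x) (hZ : CMDiffAt ∞ (T% Z) x) :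
    CMDiffAt ∞ (koszul g X Y Z) x := by
  have hYZ := contMDiffAt_mvfderiv_apply (contMDiffAt_inner g hY hZ) hX
  have hXZ := contMDiffAt_mvfderiv_apply (contMDiffAt_inner g hX hZ) hY
  have hXY := contMDiffAt_mvfderiv_apply (contMDiffAt_inner g hX hY) hZ
  exact ((((hYZ.add hXZ).sub hXY).add (contMDiffAt_inner g (contMDiffAt_mlieBracket hX hY) hZ)).sub
    (contMDiffAt_inner g (contMDiffAt_mlieBracket hX hZ) hY)).sub
    (contMDiffAt_inner g (contMDiffAt_mlieBracket hY hZ) hX)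

/-- A field is smooth as soon as its inner products with smooth fields are: in a local frame, its
coefficients are given by Cramer's rule for the Gram matrix. -/
theorem contMDiffAt_of_inner (g : RiemannianMetric E M) {V : TangentField E M} {x : M}
    (h : ∀ W : TangentField E M, CMDiffAt ∞ (T% W) x →
      CMDiffAt ∞ (fun y ↦ g.inner y (V y) (W y)) x) : CMDiffAt ∞ (T% V) x := by
  classical
  let t := trivializationAt E (TangentSpace 𝓘(ℝ, E) (M := M)) x
  have hx : x ∈ t.baseSet := FiberBundle.mem_baseSet_trivializationAt E _ x
  let b := Module.finBasis ℝ E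
  let s := t.localFrame b
  let c := t.localFrameCoeff 𝓘(ℝ, E) b
  have hs (i) : CMDiffAt ∞ (T% (s i)) x := contMDiffAt_localFrame_of_mem ∞ _ b i hx
  let G (y : M) : Matrix (Fin (Module.finrank ℝ E)) (Fin (Module.finrank ℝ E)) ℝ :=
    Matrix.of fun i j ↦ g.inner y (s j y) (s i y)
  let a (y : M) (i : Fin (Module.finrank ℝ E)) : ℝ := g.inner y (V y) (s i y)
  have hG (i j) : CMDiffAt ∞ (fun y ↦ G y i j) x := contMDiffAt_inner g (hs j) (hs i)
  have ha (i) : CMDiffAt ∞ (fun y ↦ a y i) x := h _ (hs i)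
  have hdet {y : M} (hy : y ∈ t.baseSet) : (G y).det ≠ 0 := by
    intro h0
    obtain ⟨v, hv, hGv⟩ := Matrix.exists_mulVec_eq_zero_iff.2 h0
    have hli := (t.isLocalFrameOn_localFrame_baseSet 𝓘(ℝ, E) 1 b).linearIndependent hy
    apply hv
    have hu : ∑ i, v i • s i y = 0 := by
      by_contra hne
      refine (g.pos y _ hne).ne' ?_
      have hi (i) : g.inner y (∑ j, v j • s j y) (s i y) = 0 := by
        simpa [Matrix.mulVec, dotProduct, G, mul_comm] using congrFun hGv i
      have hs' : g.inner y (∑ j, v j • s j y) (∑ i, v i • s i y) =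
          ∑ i, v i * g.inner y (∑ j, v j • s j y) (s i y) := by
        rw [map_sum (g.inner y (∑ j, v j • s j y))]
        simp only [map_smul, smul_eq_mul]
      rw [hs']
      simp only [hi, mul_zero, Finset.sum_const_zero]
    exact funext fun i ↦ Fintype.linearIndependent_iff.1 hli v hu i
  have hc {y : M} (hy : y ∈ t.baseSet) (i) :
      c i y (V y) = ((G y).updateCol i (a y)).det / (G y).det := by
    have hV : V y = ∑ i, c i y (V y) • s i y := t.eq_sum_localFrameCoeff_smul hy
    have hGc : (G y).mulVec (fun i ↦ c i y (V y)) = a y := by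
      funext i
      have := congrArg (fun u ↦ g.inner y u (s i y)) hV
      simp only [map_sum, map_smul, sum_apply, smul_apply, smul_eq_mul] at this
      simp only [a, this]
      simp [Matrix.mulVec, dotProduct, G, mul_comm]
    rw [← Matrix.cramer_apply, ← hGc, Matrix.cramer_eq_adjugate_mulVec, Matrix.mulVec_mulVec,
      Matrix.adjugate_mul, Matrix.smul_mulVec, Matrix.one_mulVec]
    simp [hdet hy]
  refine (contMDiffAt_iff_localFrameCoeff (e := t) b hx).2 fun i ↦ ?_
  have : CMDiffAt ∞ (fun y ↦ ((G y).updateCol i (a y)).det / (G y).det) x := by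
    refine (contMDiffAt_det fun k l ↦ ?_).div₀ (contMDiffAt_det hG) (hdet hx)
    by_cases hl : l = i
    · simpa [Matrix.updateCol_apply, hl] using ha k
    · simpa [Matrix.updateCol_apply, hl] using hG k l
  refine this.congr_of_eventuallyEq ?_
  filter_upwards [t.open_baseSet.mem_nhds hx] with y hy using hc hy i

theorem contMDiffAt_leviCivita (g : RiemannianMetric E M) {Y Z : TangentField E M} {x : M}
    (hY : CMDiffAt ∞ (T% Y) x) (hZ : CMDiffAt ∞ (T% Z) x) :
    CMDiffAt ∞ (T% (fun y ↦ leviCivita g Z y (Y y))) x := by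
  refine contMDiffAt_of_inner g fun W hW ↦ ?_
  have h : CMDiffAt ∞ (fun y ↦ (1 / 2 : ℝ) * koszul g Y Z W y) x :=
    contMDiffAt_const.mul (contMDiffAt_koszul g hY hZ hW)
  refine h.congr_of_eventuallyEq ?_
  filter_upwards [eventually_mdifferentiableAt_section hY, eventually_mdifferentiableAt_section hZ,
    eventually_mdifferentiableAt_section hW] with y h1 h2 h3
  have := two_mul_inner_nabla g h1 h2 h3
  change g.inner y (nabla g Z y (Y y)) (W y) = _
  linarith

/-! ### The curvature tensor -/

section Curvature

variable (g : RiemannianMetric E M) {X Y Z W : TangentField E M} {f : M → ℝ} {x : M}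

theorem leviCivita_add (hY : MDiffAt (T% Y) x) (hZ : MDiffAt (T% Z) x) :
    leviCivita g (Y + Z) x = leviCivita g Y x + leviCivita g Z x :=
  (leviCivita g).isCovariantDerivativeOnUniv.add hY hZ

theorem leviCivita_smul (hf : MDiffAt f x) (hY : MDiffAt (T% Y) x) (v : TangentSpace 𝓘(ℝ, E) x) :
    leviCivita g (f • Y) x v = f x • leviCivita g Y x v + d% f x v • Y x := by
  have := (leviCivita g).isCovariantDerivativeOnUniv.leibniz hY hf
  rw [show leviCivita g (f • Y) x = _ from this]
  rfl

theorem leviCivita_congr (hY : MDiffAt (T% Y) x) (hZ : MDiffAt (T% Z) x)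
    (h : ∀ᶠ y in 𝓝 x, Y y = Z y) : leviCivita g Y x = leviCivita g Z x :=
  (leviCivita g).isCovariantDerivativeOnUniv.congr_of_eventuallyEq hY hZ Filter.univ_mem h

theorem leviCivita_sub_leviCivita (hX : MDiffAt (T% X) x) (hY : MDiffAt (T% Y) x) :
    leviCivita g Y x (X x) - leviCivita g X x (Y x) = mlieBracket 𝓘(ℝ, E) X Y x :=
  (leviCivita g).torsion_eq_zero_iff.1 (leviCivita_torsion g) hX hY

theorem curvature_swap : curvature g X Y Z x = -curvature g Y X Z x := by
  rw [curvature, curvature, mlieBracket_swap_apply, map_neg]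
  abel

theorem curvature_congr_left (hZ : CMDiffAt ∞ (T% Z) x)
    (hX : CMDiffAt ∞ (T% X) x) (hW : CMDiffAt ∞ (T% W) x) (h : ∀ᶠ y in 𝓝 x, X y = W y) :
    curvature g X Y Z x = curvature g W Y Z x := by
  have h1 := leviCivita_congr g ((contMDiffAt_leviCivita g hX hZ).mdifferentiableAt (by simp))
    ((contMDiffAt_leviCivita g hW hZ).mdifferentiableAt (by simp)) (h.mono fun y hy ↦ by rw [hy])
  rw [curvature, curvature, h1, h.self_of_nhds, Filter.EventuallyEq.mlieBracket_vectorField_eq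
    (V₁ := X) (V := W) h (Filter.EventuallyEq.refl _ Y)]

theorem curvature_add_left (hX : CMDiffAt ∞ (T% X) x) (hW : CMDiffAt ∞ (T% W) x)
    (hZ : CMDiffAt ∞ (T% Z) x) :
    curvature g (X + W) Y Z x = curvature g X Y Z x + curvature g W Y Z x := by
  have hn : (∞ : ℕ∞ω) ≠ 0 := by simp
  have h1 := leviCivita_add g ((contMDiffAt_leviCivita g hX hZ).mdifferentiableAt hn)
    ((contMDiffAt_leviCivita g hW hZ).mdifferentiableAt hn)
  have h2 : (fun y ↦ leviCivita g Z y ((X + W) y)) =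
      (fun y ↦ leviCivita g Z y (X y)) + fun y ↦ leviCivita g Z y (W y) := by
    funext y; exact map_add _ _ _
  rw [curvature, h2, h1, mlieBracket_add_left (hX.mdifferentiableAt hn) (hW.mdifferentiableAt hn)]
  simp only [curvature, Pi.add_apply, map_add, add_apply]
  abel

theorem curvature_smul_left (hf : CMDiffAt ∞ f x) (hX : CMDiffAt ∞ (T% X) x)
    (hZ : CMDiffAt ∞ (T% Z) x) :
    curvature g (f • X) Y Z x = f x • curvature g X Y Z x := by
  have hn : (∞ : ℕ∞ω) ≠ 0 := by simp
  have h1 := leviCivita_smul g (hf.mdifferentiableAt hn)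
    ((contMDiffAt_leviCivita g hX hZ).mdifferentiableAt hn) (Y x)
  have h2 : (fun y ↦ leviCivita g Z y ((f • X) y)) = f • fun y ↦ leviCivita g Z y (X y) := by
    funext y; exact map_smul _ _ _
  rw [curvature, h2, h1, mlieBracket_smul_left (hf.mdifferentiableAt hn) (hX.mdifferentiableAt hn)]
  simp only [curvature, Pi.smul_apply', map_smul, map_add]
  module

theorem curvature_congr_right (hX : CMDiffAt ∞ (T% X) x) (hY : CMDiffAt ∞ (T% Y) x)
    (hZ : CMDiffAt ∞ (T% Z) x) (hW : CMDiffAt ∞ (T% W) x) (h : ∀ᶠ y in 𝓝 x, Z y = W y) :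
    curvature g X Y Z x = curvature g X Y W x := by
  have hn : (∞ : ℕ∞ω) ≠ 0 := by simp
  have key : ∀ᶠ y in 𝓝 x, leviCivita g Z y = leviCivita g W y := by
    filter_upwards [eventually_mdifferentiableAt_section hZ,
      eventually_mdifferentiableAt_section hW, h.eventually_nhds] with y h1 h2 h3
    exact leviCivita_congr g h1 h2 h3
  have h1 {V : TangentField E M} (hV : CMDiffAt ∞ (T% V) x) :=
    leviCivita_congr g ((contMDiffAt_leviCivita g hV hZ).mdifferentiableAt hn)
    ((contMDiffAt_leviCivita g hV hW).mdifferentiableAt hn) (key.mono fun y hy ↦ by rw [hy])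
  rw [curvature, curvature, h1 hX, h1 hY, key.self_of_nhds]

theorem curvature_add_right (hX : CMDiffAt ∞ (T% X) x) (hY : CMDiffAt ∞ (T% Y) x)
    (hZ : CMDiffAt ∞ (T% Z) x) (hW : CMDiffAt ∞ (T% W) x) :
    curvature g X Y (Z + W) x = curvature g X Y Z x + curvature g X Y W x := by
  have hn : (∞ : ℕ∞ω) ≠ 0 := by simp
  have key {V : TangentField E M} (hV : CMDiffAt ∞ (T% V) x) :
      leviCivita g (fun y ↦ leviCivita g (Z + W) y (V y)) x =
        leviCivita g (fun y ↦ leviCivita g Z y (V y)) x +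
          leviCivita g (fun y ↦ leviCivita g W y (V y)) x := by
    have h1 := contMDiffAt_leviCivita g hV hZ
    have h2 := contMDiffAt_leviCivita g hV hW
    rw [← leviCivita_add g (h1.mdifferentiableAt hn) (h2.mdifferentiableAt hn)]
    refine leviCivita_congr g ((contMDiffAt_leviCivita g hV (hZ.add_section hW)).mdifferentiableAt
      hn) ((h1.add_section h2).mdifferentiableAt hn) ?_
    filter_upwards [eventually_mdifferentiableAt_section hZ,
      eventually_mdifferentiableAt_section hW] with y h3 h4
    rw [leviCivita_add g h3 h4]
    rfl
  rw [curvature, key hX, key hY, leviCivita_add g (hZ.mdifferentiableAt hn)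
    (hW.mdifferentiableAt hn)]
  simp only [curvature, add_apply]
  abel

theorem curvature_smul_right (hX : CMDiffAt ∞ (T% X) x) (hY : CMDiffAt ∞ (T% Y) x)
    (hf : CMDiffAt ∞ f x) (hZ : CMDiffAt ∞ (T% Z) x) :
    curvature g X Y (f • Z) x = f x • curvature g X Y Z x := by
  have hn : (∞ : ℕ∞ω) ≠ 0 := by simp
  have hfd := hf.mdifferentiableAt hn
  have hZd := hZ.mdifferentiableAt hn
  have key {V : TangentField E M} (hV : CMDiffAt ∞ (T% V) x) (u : TangentSpace 𝓘(ℝ, E) x) :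
      leviCivita g (fun y ↦ leviCivita g (f • Z) y (V y)) x u =
        f x • leviCivita g (fun y ↦ leviCivita g Z y (V y)) x u +
        d% f x u • leviCivita g Z x (V x) +
          (d% f x (V x) • leviCivita g Z x u + d% (fun y ↦ d% f y (V y)) x u • Z x) := by
    have h1 := contMDiffAt_leviCivita g hV hZ
    have h2 := contMDiffAt_mvfderiv_apply hf hV
    rw [← leviCivita_smul g hfd (h1.mdifferentiableAt hn),
      ← leviCivita_smul g (h2.mdifferentiableAt hn) hZd, ← add_apply,
      ← leviCivita_add g ((hf.smul_section h1).mdifferentiableAt hn)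
        ((h2.smul_section hZ).mdifferentiableAt hn)]
    congr 1
    refine leviCivita_congr g ((contMDiffAt_leviCivita g hV (hf.smul_section hZ)).mdifferentiableAt
      hn) (((hf.smul_section h1).add_section (h2.smul_section hZ)).mdifferentiableAt hn) ?_
    filter_upwards [eventually_mdifferentiableAt_section hZ,
      eventually_mdifferentiableAt hf] with y h3 h4
    rw [leviCivita_smul g h4 h3]
    rfl
  rw [curvature, key hX, key hY, leviCivita_smul g hfd hZd, mvfderiv_mlieBracket hX hY hf,
    curvature]
  module

/-- The curvature is a tensor: its value depends only on the values of the smooth fields. -/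
theorem curvature_eq_curvatureAt (hX : CMDiffAt ∞ (T% X) x) (hY : CMDiffAt ∞ (T% Y) x)
    (hZ : CMDiffAt ∞ (T% Z) x) :
    curvature g X Y Z x = curvatureAt g x (X x) (Y x) (Z x) := by
  have hext (v : TangentSpace 𝓘(ℝ, E) x) : CMDiffAt ∞ (T% (extend E v)) x :=
    contMDiffAt_extend 𝓘(ℝ, E) E v
  have left {X Y : TangentField E M} (hX : CMDiffAt ∞ (T% X) x) :
      curvature g X Y Z x = curvature g (extend E (X x)) Y Z x :=
    eq_of_smooth_tensorial (Φ := fun V ↦ curvature g V Y Z x)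
      (fun hV hW h ↦ curvature_congr_left g hZ hV hW h)
      (fun hV hW ↦ curvature_add_left g hV hW hZ) (fun hf hV ↦ curvature_smul_left g hf hV hZ)
      hX (hext _) (extend_apply_self ..).symm
  rw [left hX, curvature_swap, left hY, curvature_swap, neg_neg]
  exact eq_of_smooth_tensorial (Φ := fun V ↦ curvature g _ _ V x)
    (fun hV hW h ↦ curvature_congr_right g (hext _) (hext _) hV hW h)
    (fun hV hW ↦ curvature_add_right g (hext _) (hext _) hV hW)
    (fun hf hV ↦ curvature_smul_right g (hext _) (hext _) hf hV) hZ (hext _)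
    (extend_apply_self ..).symm

/-- The first Bianchi identity. -/
theorem curvature_bianchi (hX : CMDiffAt ∞ (T% X) x) (hY : CMDiffAt ∞ (T% Y) x)
    (hZ : CMDiffAt ∞ (T% Z) x) :
    curvature g X Y Z x + curvature g Y Z X x + curvature g Z X Y x = 0 := by
  have hn : (∞ : ℕ∞ω) ≠ 0 := by simp
  have key {V W : TangentField E M} (hV : CMDiffAt ∞ (T% V) x) (hW : CMDiffAt ∞ (T% W) x) :
      leviCivita g (fun y ↦ leviCivita g W y (V y)) x =
        leviCivita g (fun y ↦ leviCivita g V y (W y)) x +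
          leviCivita g (mlieBracket 𝓘(ℝ, E) V W) x := by
    have h1 := contMDiffAt_leviCivita g hW hV
    have h2 := contMDiffAt_mlieBracket hV hW
    rw [← leviCivita_add g (h1.mdifferentiableAt hn) (h2.mdifferentiableAt hn)]
    refine leviCivita_congr g ((contMDiffAt_leviCivita g hV hW).mdifferentiableAt
      hn) ((h1.add_section h2).mdifferentiableAt hn) ?_
    filter_upwards [eventually_mdifferentiableAt_section hV,
      eventually_mdifferentiableAt_section hW] with y h3 h4
    have := leviCivita_sub_leviCivita g h3 h4
    rw [Pi.add_apply, ← this]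
    abel
  have tor {V W : TangentField E M} (hV : CMDiffAt ∞ (T% V) x) (hW : CMDiffAt ∞ (T% W) x) :=
    leviCivita_sub_leviCivita g (hV.mdifferentiableAt hn) (hW.mdifferentiableAt hn)
  have tX := tor hX (contMDiffAt_mlieBracket hY hZ)
  have tY := tor hY (contMDiffAt_mlieBracket hZ hX)
  have tZ := tor hZ (contMDiffAt_mlieBracket hX hY)
  have J := jacobi_mlieBracket hX hY hZ
  have e1 : mlieBracket 𝓘(ℝ, E) (mlieBracket 𝓘(ℝ, E) X Y) Z x =
      -mlieBracket 𝓘(ℝ, E) Z (mlieBracket 𝓘(ℝ, E) X Y) x := mlieBracket_swap_apply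
  have e2 : mlieBracket 𝓘(ℝ, E) Y (mlieBracket 𝓘(ℝ, E) X Z) x =
      -mlieBracket 𝓘(ℝ, E) Y (mlieBracket 𝓘(ℝ, E) Z X) x := by
    rw [mlieBracket_swap (V := X) (W := Z)]
    have := mlieBracket_const_smul_right (I := 𝓘(ℝ, E)) (V := Y) (c := (-1 : ℝ))
      ((contMDiffAt_mlieBracket hZ hX).mdifferentiableAt hn)
    simpa using this
  rw [e1, e2, ← tX, ← tY, ← tZ] at J
  rw [curvature, curvature, curvature, key hY hZ, key hZ hX, key hX hY]
  simp only [add_apply]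
  rw [← sub_eq_zero] at J
  rw [← J]
  abel

/-- The curvature operator `R(X, Y)` is skew-symmetric. -/
theorem inner_curvature_add_inner_curvature (hX : CMDiffAt ∞ (T% X) x) (hY : CMDiffAt ∞ (T% Y) x)
    (hZ : CMDiffAt ∞ (T% Z) x) (hW : CMDiffAt ∞ (T% W) x) :
    g.inner x (curvature g X Y Z x) (W x) + g.inner x (Z x) (curvature g X Y W x) = 0 := by
  have hn : (∞ : ℕ∞ω) ≠ 0 := by simp
  have hZd := hZ.mdifferentiableAt hn
  have hWd := hW.mdifferentiableAt hn
  have key {V : TangentField E M} (hV : CMDiffAt ∞ (T% V) x) (u : TangentSpace 𝓘(ℝ, E) x) :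
      d% (fun y ↦ d% (fun y ↦ g.inner y (Z y) (W y)) y (V y)) x u =
        g.inner x (leviCivita g (fun y ↦ leviCivita g Z y (V y)) x u) (W x) +
          g.inner x (leviCivita g Z x (V x)) (leviCivita g W x u) +
        (g.inner x (leviCivita g Z x u) (leviCivita g W x (V x)) +
          g.inner x (Z x) (leviCivita g (fun y ↦ leviCivita g W y (V y)) x u)) := by
    have h1 := (contMDiffAt_leviCivita g hV hZ).mdifferentiableAt hn
    have h2 := (contMDiffAt_leviCivita g hV hW).mdifferentiableAt hn
    rw [← leviCivita_metric g h1 hWd, ← leviCivita_metric g hZd h2, ← add_apply,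
      ← mvfderiv_fun_add (mdifferentiableAt_inner g h1 hWd) (mdifferentiableAt_inner g hZd h2)]
    have e : (fun y ↦ d% (fun y ↦ g.inner y (Z y) (W y)) y (V y)) =ᶠ[𝓝 x] fun y ↦
        g.inner y (leviCivita g Z y (V y)) (W y) + g.inner y (Z y) (leviCivita g W y (V y)) := by
      filter_upwards [eventually_mdifferentiableAt_section hZ,
        eventually_mdifferentiableAt_section hW] with y h3 h4
      exact leviCivita_metric g h3 h4 _
    rw [mvfderiv, mvfderiv, e.mfderiv_eq]
    rfl
  have h := mvfderiv_mlieBracket hX hY (contMDiffAt_inner g hZ hW)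
  rw [key hY, key hX, leviCivita_metric g hZd hWd] at h
  simp only [curvature, map_sub, sub_apply]
  linarith

end Curvature

/-! ### Algebra at a point -/

section Algebra

variable {V : Type*} [AddCommGroup V] [Module ℝ V]

/-- An almost contact metric structure on a vector space `V`, with the metric `B`. -/
structure LinearAlmostContact (B : V →ₗ[ℝ] V →ₗ[ℝ] ℝ) (φ : V →ₗ[ℝ] V) (ξ : V)
    (η : V →ₗ[ℝ] ℝ) : Prop where
  symm : ∀ v w, B v w = B w v
  nondegenerate : ∀ v, (∀ w, B v w = 0) → v = 0
  φ_φ : ∀ v, φ (φ v) = -v + η v • ξ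
  η_ξ : η ξ = 1
  compatible : ∀ v w, B (φ v) (φ w) = B v w - η v * η w

namespace LinearAlmostContact

variable {B : V →ₗ[ℝ] V →ₗ[ℝ] ℝ} {φ : V →ₗ[ℝ] V} {ξ : V} {η : V →ₗ[ℝ] ℝ}
  (L : LinearAlmostContact B φ ξ η)
include L

theorem ext {v w : V} (h : ∀ u, B v u = B w u) : v = w :=
  sub_eq_zero.1 (L.nondegenerate _ fun u ↦ by simp [h])

theorem φ_ξ : φ ξ = 0 := by
  have h2 : φ (φ ξ) = 0 := by rw [L.φ_φ, L.η_ξ]; simp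
  have h3 : φ ξ = η (φ ξ) • ξ := by
    have := L.φ_φ (φ ξ)
    rw [h2, map_zero] at this
    rwa [eq_comm, neg_add_eq_zero] at this
  have h4 : (η (φ ξ) * η (φ ξ)) • ξ = 0 := by
    rw [mul_smul, ← h3, ← map_smul, ← h3, h2]
  have h5 : η (φ ξ) = 0 := by
    have := congrArg η h4
    simpa [L.η_ξ] using this
  rw [h3, h5, zero_smul]

theorem η_φ (v : V) : η (φ v) = 0 := by
  have h := L.φ_φ (φ v)
  rw [L.φ_φ v, map_add, map_neg, map_smul, L.φ_ξ] at h
  have h1 : η (φ v) • ξ = 0 := by simpa using h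
  simpa [L.η_ξ] using congrArg η h1

theorem inner_ξ (v : V) : B v ξ = η v := by
  have := L.compatible v ξ
  rw [L.φ_ξ, L.η_ξ, map_zero] at this
  linarith

theorem inner_φ_left (v w : V) : B (φ v) w = -B v (φ w) := by
  have := L.compatible (φ v) w
  rw [L.φ_φ, L.η_φ, map_add, map_neg, map_smul, LinearMap.add_apply, LinearMap.neg_apply,
    LinearMap.smul_apply, L.symm ξ, L.inner_ξ, L.η_φ] at this
  simp only [smul_zero, zero_mul] at this
  linarith

/-- If `dη = 0`, `dΦ = 0` and `[φ, φ] = 0` then `∇ξ = 0` and `∇φ = 0`. Here `h u` stands for `∇_u ξ`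
and `A u v` for `(∇_u φ) v`. -/
theorem eq_zero_of_closed_of_normal {h : V →ₗ[ℝ] V} {A : V → V → V}
    (h_symm : ∀ u v, B (h u) v = B (h v) u) (h_unit : ∀ u, B (h u) ξ = 0)
    (A_zero : ∀ v, A 0 v = 0)
    (A_skew : ∀ u v w, B (A u v) w + B v (A u w) = 0)
    (A_ξ : ∀ u, A u ξ = -φ (h u))
    (A_φ : ∀ u v, A u (φ v) + φ (A u v) = B (h u) v • ξ + η v • h u)
    (A_cyclic : ∀ u v w, B v (A u w) + B w (A v u) + B u (A w v) = 0)
    (A_normal : ∀ u v, A (φ u) v - A (φ v) u + φ (A v u) - φ (A u v) = 0) :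
    (∀ u, h u = 0) ∧ ∀ u v, A u v = 0 := by
  have hξ : h ξ = 0 := L.nondegenerate _ fun w ↦ by rw [h_symm, h_unit]
  have hη (u : V) : η (h u) = 0 := by rw [← L.inner_ξ, h_unit]
  have hφφ (u : V) : φ (φ (h u)) = -h u := by rw [L.φ_φ, hη, zero_smul, add_zero]
  -- Normality and `dΦ = 0`, each with one argument equal to `ξ`, both determine `A ξ`.
  have h1 (u : V) : φ (A ξ u) = h u + φ (h (φ u)) := by
    have := A_normal u ξ
    rw [L.φ_ξ, A_zero, A_ξ, A_ξ, map_neg, hφφ] at this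
    rw [← sub_eq_zero, ← this]
    abel
  have h2 (u : V) : A ξ u = -h (φ u) - φ (h u) := by
    refine L.ext fun v ↦ ?_
    have e := A_cyclic ξ v u
    have e1 := A_skew u ξ v
    rw [A_ξ, map_neg, LinearMap.neg_apply, L.inner_φ_left] at e1
    rw [A_ξ, map_neg] at e
    simp only [map_sub, map_neg, LinearMap.sub_apply, LinearMap.neg_apply]
    have e2 := h_symm v (φ u)
    have e3 := L.inner_φ_left u (h v)
    have e4 := L.symm (φ u) (h v)
    have e5 := L.inner_φ_left (h u) v
    have e6 := L.symm v (A ξ u)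
    linarith
  have h3 (u : V) : φ (h (φ u)) = 0 := by
    have := h1 u
    rw [h2, map_sub, map_neg, hφφ] at this
    have h4 : (2 : ℝ) • φ (h (φ u)) = 0 := by
      rw [← sub_eq_zero.2 this.symm]
      module
    exact (smul_eq_zero.1 h4).resolve_left two_ne_zero
  have h4 (u : V) : h u = 0 := by
    have := h3 (φ u)
    rw [L.φ_φ, map_add, map_neg, map_smul, hξ, smul_zero, add_zero, map_neg, neg_eq_zero] at this
    rw [← neg_eq_zero, ← hφφ, this, map_zero]
  refine ⟨h4, fun u v ↦ L.ext fun w ↦ ?_⟩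
  have A_φ' (u v : V) : A u (φ v) = -φ (A u v) := by
    have := A_φ u v
    rwa [h4, map_zero, LinearMap.zero_apply, zero_smul, smul_zero, add_zero,
      add_eq_zero_iff_eq_neg] at this
  -- Moving `φ` from `v` to `u` changes nothing, because `A w` anticommutes with `φ` and `φ` is
  -- skew; by normality and `dΦ = 0` it also changes the sign.
  have key (u v w : V) : B (A w u) (φ v) = 0 := by
    have n := congrArg (fun z ↦ B z w) (A_normal u v)
    simp only [map_add, map_sub, map_zero, LinearMap.add_apply, LinearMap.sub_apply,
      LinearMap.zero_apply] at n
    have p (u v w : V) : B (φ (A u v)) w = -B (A u (φ v)) w := by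
      rw [A_φ', map_neg, LinearMap.neg_apply, neg_neg]
    have c (u v w : V) : B (A u w) v + B (A v u) w + B (A w v) u = 0 := by
      rw [L.symm (A u w), L.symm (A v u), L.symm (A w v)]
      exact A_cyclic u v w
    have k (u v w : V) : B (A u v) w = -B (A u w) v := by
      rw [L.symm (A u w)]
      linarith [A_skew u v w]
    have q := L.inner_φ_left (A w u) v
    linarith [p v u w, p u v w, p w u v, c (φ u) v w, c u (φ v) w, k (φ u) w v, k v (φ u) w,
      k w v (φ u), k u w (φ v), k (φ v) u w, k w (φ v) u]
  have hw : w = -φ (φ w) + η w • ξ := by rw [L.φ_φ]; abel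
  have hz := A_skew u v ξ
  rw [A_ξ, h4, map_zero, neg_zero, map_zero, add_zero] at hz
  rw [hw, map_add, map_neg, map_smul, key, hz]
  simp

/-- If the curvature operators commute with `φ`, the symmetry of the curvature tensor `R` under
exchange of the two pairs gives `R(φ u, v) = -R(u, φ v)`. -/
theorem curvature_φ_left {R : V → V → V → V}
    (swap : ∀ u v w, R u v w = -R v u w)
    (bianchi : ∀ u v w, R u v w + R v w u + R w u v = 0)
    (skew : ∀ u v w z, B (R u v w) z + B w (R u v z) = 0)
    (R_φ : ∀ u v w, R u v (φ w) = φ (R u v w)) (u v w : V) :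
    R (φ u) v w = -R u (φ v) w := by
  have s1 (u v w z : V) : B (R u v w) z = -B (R v u w) z := by rw [swap]; simp
  have s2 (u v w z : V) : B (R u v w) z = -B (R u v z) w := by
    rw [L.symm (R u v z)]; linarith [skew u v w z]
  have s3 (u v w z : V) : B (R u v w) z + B (R v w u) z + B (R w u v) z = 0 := by
    simpa using congrArg (fun y ↦ B y z) (bianchi u v w)
  -- Pair symmetry is a combination of the four Bianchi identities on three of `u`, `v`, `w`, `z`.
  have pair (u v w z : V) : B (R u v w) z = B (R w z u) v := by
    linarith [s3 u v w z, s3 v w z u, s3 w z u v, s3 z u v w, s1 u v w z, s2 u v w z, s1 v w u z,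
      s2 v w u z, s1 w u v z, s2 w u v z, s1 v w z u, s1 w z v u, s2 w z v u, s1 z v w u,
      s2 z v w u, s1 w z u v, s1 z u w v, s2 z u w v, s1 u w z v, s2 u w z v, s1 z u v w,
      s1 u v z w, s1 v z u w, s2 v z u w, s2 w z u v]
  refine L.ext fun z ↦ ?_
  rw [map_neg, LinearMap.neg_apply, pair (φ u), pair u, R_φ, L.inner_φ_left]

end LinearAlmostContact
end Algebra

/-! ### Parallelism of the structure and the Ricci operator -/

variable {g : RiemannianMetric E M}

section CurvatureAt

variable (g) (x : M) (u v w z : TangentSpace 𝓘(ℝ, E) x)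

theorem curvatureAt_add_left :
    curvatureAt g x (u + v) w z = curvatureAt g x u w z + curvatureAt g x v w z := by
  have hu := contMDiffAt_extend_infty u
  have hv := contMDiffAt_extend_infty v
  have hz := contMDiffAt_extend_infty z
  have h := curvature_add_left g (Y := extend E w) hu hv hz
  rw [curvature_eq_curvatureAt g (hu.add_section hv) (contMDiffAt_extend_infty w) hz] at h
  simpa using! h

theorem curvatureAt_smul_left (c : ℝ) :
    curvatureAt g x (c • u) w z = c • curvatureAt g x u w z := by
  have hu := contMDiffAt_extend_infty u
  have hz := contMDiffAt_extend_infty z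
  have hc : CMDiffAt ∞ (fun _ : M ↦ c) x := contMDiffAt_const
  have h := curvature_smul_left g (Y := extend E w) hc hu hz
  rw [curvature_eq_curvatureAt g (hc.smul_section hu) (contMDiffAt_extend_infty w) hz] at h
  simpa using! h

theorem curvatureAt_add_right :
    curvatureAt g x u v (w + z) = curvatureAt g x u v w + curvatureAt g x u v z := by
  have hu := contMDiffAt_extend_infty u
  have hv := contMDiffAt_extend_infty v
  have hw := contMDiffAt_extend_infty w
  have hz := contMDiffAt_extend_infty z
  have h := curvature_add_right g hu hv hw hz
  rw [curvature_eq_curvatureAt g hu hv (hw.add_section hz)] at h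
  simpa using! h

theorem curvatureAt_smul_right (c : ℝ) :
    curvatureAt g x u v (c • w) = c • curvatureAt g x u v w := by
  have hu := contMDiffAt_extend_infty u
  have hv := contMDiffAt_extend_infty v
  have hw := contMDiffAt_extend_infty w
  have hc : CMDiffAt ∞ (fun _ : M ↦ c) x := contMDiffAt_const
  have h := curvature_smul_right g hu hv hc hw
  rw [curvature_eq_curvatureAt g hu hv (hc.smul_section hw)] at h
  simpa using! h

theorem curvatureAt_swap : curvatureAt g x u v w = -curvatureAt g x v u w :=
  curvature_swap g

theorem curvatureAt_bianchi :
    curvatureAt g x u v w + curvatureAt g x v w u + curvatureAt g x w u v = 0 :=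
  curvature_bianchi g (contMDiffAt_extend_infty u) (contMDiffAt_extend_infty v)
    (contMDiffAt_extend_infty w)

theorem inner_curvatureAt_add_inner_curvatureAt :
    g.inner x (curvatureAt g x u v w) z + g.inner x w (curvatureAt g x u v z) = 0 := by
  simpa using! inner_curvature_add_inner_curvature g (contMDiffAt_extend_infty u)
    (contMDiffAt_extend_infty v) (contMDiffAt_extend_infty w) (contMDiffAt_extend_infty z)

end CurvatureAt

namespace AlmostContactStructure

variable {S : AlmostContactStructure E M} {X Y Z : TangentField E M} {x : M}

theorem IsCompatible.linearAlmostContact (hS : S.IsCompatible g) (x : M) :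
    LinearAlmostContact (innerₗ g x) (S.φ x : TangentSpace 𝓘(ℝ, E) x →ₗ[ℝ] TangentSpace 𝓘(ℝ, E) x)
      (S.ξ x) (S.η x : TangentSpace 𝓘(ℝ, E) x →ₗ[ℝ] ℝ) where
  symm v w := g.symm x v w
  nondegenerate v h := inner_ext g fun w ↦ by simpa using h w
  φ_φ v := S.φ_φ x v
  η_ξ := S.η_ξ x
  compatible v w := hS x v w

variable (S g) in
/-- The covariant derivative `(∇_u φ) v = ∇_u (φ V) - φ (∇_u V)`, where `V` is a field with the
value `v` at `x`. -/
def covDerivφ (x : M) (u v : TangentSpace 𝓘(ℝ, E) x) : TangentSpace 𝓘(ℝ, E) x :=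
  leviCivita g (fun y ↦ S.φ y (extend E v y)) x u - S.φ x (leviCivita g (extend E v) x u)

/-- The definition of `∇φ` may be tested on any differentiable field, because it is tensorial. -/
theorem leviCivita_φ_apply (hY : MDiffAt (T% Y) x) (u : TangentSpace 𝓘(ℝ, E) x) :
    leviCivita g (fun y ↦ S.φ y (Y y)) x u =
      S.covDerivφ g x u (Y x) + S.φ x (leviCivita g Y x u) := by
  have ht : TensorialAt 𝓘(ℝ, E) E (fun V : TangentField E M ↦
      leviCivita g (fun y ↦ S.φ y (V y)) x u - S.φ x (leviCivita g V x u)) x :=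
    { smul := fun {f V} hf hV ↦ by
        have e : (fun y ↦ S.φ y ((f • V) y)) = f • fun y ↦ S.φ y (V y) :=
          funext fun y ↦ map_smul _ _ _
        rw [e, leviCivita_smul g hf (S.mdifferentiableAt_φ_apply hV), leviCivita_smul g hf hV,
          map_add, map_smul, map_smul]
        module
      add := fun {V W} hV hW ↦ by
        have e : (fun y ↦ S.φ y ((V + W) y)) = (fun y ↦ S.φ y (V y)) + fun y ↦ S.φ y (W y) :=
          funext fun y ↦ map_add _ _ _
        rw [e, leviCivita_add g (S.mdifferentiableAt_φ_apply hV) (S.mdifferentiableAt_φ_apply hW),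
          leviCivita_add g hV hW, add_apply, add_apply, map_add]
        abel }
  have h := ht.pointwise hY (mdifferentiableAt_extend 𝓘(ℝ, E) E (Y x)) (extend_apply_self ..).symm
  rw [covDerivφ, ← h]
  abel

variable (hS : S.IsCoKahler g)
include hS

theorem IsCoKahler.η_eq_inner (x : M) (v : TangentSpace 𝓘(ℝ, E) x) :
    S.η x v = g.inner x (S.ξ x) v := by
  rw [g.symm]
  exact ((hS.compatible.linearAlmostContact x).inner_ξ v).symm

theorem IsCoKahler.inner_φ_left (x : M) (v w : TangentSpace 𝓘(ℝ, E) x) :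
    g.inner x (S.φ x v) w = -g.inner x v (S.φ x w) :=
  (hS.compatible.linearAlmostContact x).inner_φ_left v w

theorem IsCoKahler.mvfderiv_η_apply (hY : MDiffAt (T% Y) x) (u : TangentSpace 𝓘(ℝ, E) x) :
    d% (fun y ↦ S.η y (Y y)) x u =
      g.inner x (leviCivita g S.ξ x u) (Y x) + S.η x (leviCivita g Y x u) := by
  have e : (fun y ↦ S.η y (Y y)) = fun y ↦ g.inner y (S.ξ y) (Y y) :=
    funext fun y ↦ hS.η_eq_inner y _
  rw [e, leviCivita_metric g S.mdifferentiableAt_ξ hY, hS.η_eq_inner]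

/-- On a coKähler manifold, `ξ` and `φ` are parallel. -/
theorem IsCoKahler.parallel (x : M) :
    (∀ u, leviCivita g S.ξ x u = 0) ∧ ∀ u v, S.covDerivφ g x u v = 0 := by
  have hn : (∞ : ℕ∞ω) ≠ 0 := by simp
  have L := hS.compatible.linearAlmostContact x
  have hs (v : TangentSpace 𝓘(ℝ, E) x) : CMDiffAt ∞ (T% (extend E v)) x :=
    contMDiffAt_extend_infty v
  have hd (v : TangentSpace 𝓘(ℝ, E) x) : MDiffAt (T% (extend E v)) x :=
    (hs v).mdifferentiableAt hn
  have hφd (v : TangentSpace 𝓘(ℝ, E) x) : MDiffAt (T% (fun y ↦ S.φ y (extend E v y))) x :=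
    S.mdifferentiableAt_φ_apply (hd v)
  have hx (v : TangentSpace 𝓘(ℝ, E) x) : extend E v x = v := extend_apply_self ..
  have A_def (u v : TangentSpace 𝓘(ℝ, E) x) :
      leviCivita g (fun y ↦ S.φ y (extend E v y)) x u =
        S.covDerivφ g x u v + S.φ x (leviCivita g (extend E v) x u) := by
    rw [leviCivita_φ_apply (hd v), hx]
  have tor {V W : TangentField E M} (hV : MDiffAt (T% V) x) (hW : MDiffAt (T% W) x) :
      mlieBracket 𝓘(ℝ, E) V W x = leviCivita g W x (V x) - leviCivita g V x (W x) :=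
    (leviCivita_sub_leviCivita g hV hW).symm
  refine L.eq_zero_of_closed_of_normal
    (h := (leviCivita g S.ξ x : TangentSpace 𝓘(ℝ, E) x →ₗ[ℝ] TangentSpace 𝓘(ℝ, E) x))
    (A := S.covDerivφ g x) (fun u v ↦ ?_) (fun u ↦ ?_) (fun v ↦ ?_) (fun u v w ↦ ?_) (fun u ↦ ?_)
    (fun u v ↦ ?_) (fun u v w ↦ ?_) (fun u v ↦ ?_)
  · have h := hS.closed_η x _ _ (hs u) (hs v)
    rw [hS.mvfderiv_η_apply (hd u), hS.mvfderiv_η_apply (hd v), tor (hd u) (hd v)] at h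
    simp only [map_sub, hx] at h
    simp only [innerₗ_apply, ContinuousLinearMap.coe_coe]
    linarith
  · have h := hS.mvfderiv_η_apply (x := x) S.mdifferentiableAt_ξ u
    have e : (fun y ↦ S.η y (S.ξ y)) = fun _ ↦ 1 := funext S.η_ξ
    rw [e, mvfderiv_const, zero_apply, hS.η_eq_inner, g.symm x (S.ξ x)] at h
    simp only [innerₗ_apply, ContinuousLinearMap.coe_coe]
    linarith
  · simp [covDerivφ]
  · have e : (fun y ↦ g.inner y (S.φ y (extend E v y)) (extend E w y)) =
        fun y ↦ -g.inner y (extend E v y) (S.φ y (extend E w y)) :=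
      funext fun y ↦ hS.inner_φ_left y _ _
    have h1 := leviCivita_metric g (hφd v) (hd w) u
    have h2 := leviCivita_metric g (hd v) (hφd w) u
    have h3 : d% (fun y ↦ -g.inner y (extend E v y) (S.φ y (extend E w y))) x u =
        -d% (fun y ↦ g.inner y (extend E v y) (S.φ y (extend E w y))) x u := by
      rw [show (fun y ↦ -g.inner y (extend E v y) (S.φ y (extend E w y))) =
        -(fun y ↦ g.inner y (extend E v y) (S.φ y (extend E w y))) from rfl, mvfderiv_neg]
      rfl
    rw [e, h3, h2, A_def, A_def, hx, hx] at h1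
    simp only [map_add, add_apply, hS.inner_φ_left] at h1
    simp only [innerₗ_apply]
    linarith
  · have h := leviCivita_φ_apply (g := g) (S := S) (x := x) S.mdifferentiableAt_ξ u
    have e : (fun y ↦ S.φ y (S.ξ y)) = 0 :=
      funext fun y ↦ (hS.compatible.linearAlmostContact y).φ_ξ
    have h0 : leviCivita g (0 : TangentField E M) x = 0 :=
      (leviCivita g).isCovariantDerivativeOnUniv.zero
    rw [e, h0, zero_apply] at h
    exact eq_neg_of_add_eq_zero_left h.symm
  · have h := leviCivita_φ_apply (g := g) (S := S) (hφd v) u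
    have e : (fun y ↦ S.φ y (S.φ y (extend E v y))) =
        (-1 : ℝ) • extend E v + (fun y ↦ S.η y (extend E v y)) • S.ξ :=
      funext fun y ↦ by simpa using S.φ_φ y _
    have hη := (S.contMDiffAt_η_apply (hs v)).mdifferentiableAt hn
    rw [e, leviCivita_add g ((hd v).smul_const_section (a := -1)) (hη.smul_section
      S.mdifferentiableAt_ξ), (leviCivita g).isCovariantDerivativeOnUniv.smul_const _ (hd v),
      add_apply, leviCivita_smul g hη S.mdifferentiableAt_ξ, hS.mvfderiv_η_apply (hd v), A_def,
      map_add, S.φ_φ, hx, smul_apply] at h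
    simp only [innerₗ_apply, ContinuousLinearMap.coe_coe]
    rw [← sub_eq_zero] at h ⊢
    rw [← neg_eq_zero, ← h]
    module
  · have h := hS.closed_Φ x _ _ _ (hs u) (hs v) (hs w)
    simp only [fundamentalForm] at h
    rw [leviCivita_metric g (hd v) (hφd w), leviCivita_metric g (hd w) (hφd u),
      leviCivita_metric g (hd u) (hφd v), tor (hd u) (hd v), tor (hd v) (hd w), tor (hd w) (hd u),
      A_def, A_def, A_def, hx, hx, hx] at h
    have k (a b : TangentSpace 𝓘(ℝ, E) x) :
        g.inner x a (S.φ x b) = -g.inner x b (S.φ x a) := by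
      rw [← hS.inner_φ_left, g.symm]
    simp only [map_add, map_sub, sub_apply, k u, k v, k w] at h
    simp only [innerₗ_apply]
    simp only [k _ u, k _ v, k _ w] at h ⊢
    linarith
  · have h := hS.normal.nijenhuis_φ hS.closed_η (hs u) (hs v)
    rw [nijenhuis, tor (hd u) (hd v), tor (hφd u) (hφd v), tor (hφd u) (hd v),
      tor (hd u) (hφd v)] at h
    simp only [A_def, hx, map_sub, map_add] at h
    simp only [ContinuousLinearMap.coe_coe]
    rw [← h]
    abel

theorem IsCoKahler.leviCivita_φ (hY : MDiffAt (T% Y) x) (u : TangentSpace 𝓘(ℝ, E) x) :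
    leviCivita g (fun y ↦ S.φ y (Y y)) x u = S.φ x (leviCivita g Y x u) := by
  rw [leviCivita_φ_apply hY, (hS.parallel x).2, zero_add]

/-- The curvature operators commute with `φ`, because `φ` is parallel. -/
theorem IsCoKahler.curvatureAt_φ (x : M) (u v w : TangentSpace 𝓘(ℝ, E) x) :
    curvatureAt g x u v (S.φ x w) = S.φ x (curvatureAt g x u v w) := by
  have hn : (∞ : ℕ∞ω) ≠ 0 := by simp
  have hu := contMDiffAt_extend_infty u
  have hv := contMDiffAt_extend_infty v
  have hw := contMDiffAt_extend_infty w
  have hφw := S.contMDiffAt_φ_apply hw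
  have key {V : TangentField E M} (hV : CMDiffAt ∞ (T% V) x) (a : TangentSpace 𝓘(ℝ, E) x) :
      leviCivita g (fun y ↦ leviCivita g (fun z ↦ S.φ z (extend E w z)) y (V y)) x a =
        S.φ x (leviCivita g (fun y ↦ leviCivita g (extend E w) y (V y)) x a) := by
    have h1 := (contMDiffAt_leviCivita g hV hw).mdifferentiableAt hn
    rw [← hS.leviCivita_φ h1]
    congr 1
    refine leviCivita_congr g ((contMDiffAt_leviCivita g hV hφw).mdifferentiableAt hn)
      (S.mdifferentiableAt_φ_apply h1) ?_
    filter_upwards [eventually_mdifferentiableAt_section hw] with y hy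
    exact hS.leviCivita_φ hy _
  have h := curvature_eq_curvatureAt g hu hv hφw
  simp only [extend_apply_self] at h
  rw [← h, curvatureAt, curvature, curvature, key hu, key hv,
    hS.leviCivita_φ (hw.mdifferentiableAt hn), map_sub, map_sub]

theorem IsCoKahler.curvatureAt_φ_left (x : M) (u v w : TangentSpace 𝓘(ℝ, E) x) :
    curvatureAt g x (S.φ x u) v w = -curvatureAt g x u (S.φ x v) w :=
  (hS.compatible.linearAlmostContact x).curvature_φ_left (R := curvatureAt g x)
    (curvatureAt_swap g x) (curvatureAt_bianchi g x) (inner_curvatureAt_add_inner_curvatureAt g x)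
    (hS.curvatureAt_φ x) u v w

/-- `Ric(φ v, w) = -Ric(v, φ w)`: with `L u = R(u, v) w`, the left side is `-tr (L ∘ φ)` and the
right side is `-tr (φ ∘ L)`. -/
theorem IsCoKahler.ricci_φ_left (x : M) (v w : TangentSpace 𝓘(ℝ, E) x) :
    ricci g x (S.φ x v) w = -ricci g x v (S.φ x w) := by
  let e := orthonormalBasis g x
  let L : TangentSpace 𝓘(ℝ, E) x →ₗ[ℝ] TangentSpace 𝓘(ℝ, E) x :=
    { toFun := fun u ↦ curvatureAt g x u v w
      map_add' := fun a b ↦ curvatureAt_add_left g x a b v w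
      map_smul' := fun c a ↦ curvatureAt_smul_left g x a v w c }
  have hL (i) : curvatureAt g x (e i) (S.φ x v) w = -L (S.φ x (e i)) := by
    rw [← neg_eq_iff_eq_neg, ← hS.curvatureAt_φ_left]
    rfl
  have hR (i) : curvatureAt g x (e i) v (S.φ x w) = S.φ x (L (e i)) := hS.curvatureAt_φ x _ _ _
  have expand (u : TangentSpace 𝓘(ℝ, E) x) : L u = ∑ j, g.inner x u (e j) • L (e j) := by
    conv_lhs => rw [← sum_inner_smul_orthonormalBasis g x u]
    simp [e]
  have h1 : ricci g x (S.φ x v) w =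
      -∑ i, ∑ j, g.inner x (S.φ x (e i)) (e j) * g.inner x (L (e j)) (e i) := by
    simp only [ricci, ← Finset.sum_neg_distrib]
    refine Finset.sum_congr rfl fun i _ ↦ ?_
    change g.inner x (curvatureAt g x (e i) (S.φ x v) w) (e i) = _
    rw [hL, expand]
    simp
  have h2 : ricci g x v (S.φ x w) =
      ∑ j, ∑ i, g.inner x (S.φ x (e i)) (e j) * g.inner x (L (e j)) (e i) := by
    simp only [ricci]
    refine Finset.sum_congr rfl fun j _ ↦ ?_
    change g.inner x (curvatureAt g x (e j) v (S.φ x w)) (e j) = _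
    rw [hR]
    conv_lhs => rw [← sum_inner_smul_orthonormalBasis g x (L (e j))]
    simp only [map_sum, map_smul, sum_apply, smul_apply, smul_eq_mul]
    exact Finset.sum_congr rfl fun i _ ↦ mul_comm _ _
  rw [h1, h2, Finset.sum_comm]

end AlmostContactStructure

theorem inner_ricciOperator (x : M) (v w : TangentSpace 𝓘(ℝ, E) x) :
    g.inner x (ricciOperator g x v) w = ricci g x v w := by
  let T : TangentSpace 𝓘(ℝ, E) x →ₗ[ℝ] ℝ :=
    { toFun := ricci g x v
      map_add' := fun a b ↦ by simp [ricci, curvatureAt_add_right, Finset.sum_add_distrib]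
      map_smul' := fun c a ↦ by simp [ricci, curvatureAt_smul_right, Finset.mul_sum] }
  change _ = T w
  conv_rhs => rw [← sum_inner_smul_orthonormalBasis g x w]
  simp only [ricciOperator, map_sum, map_smul, sum_apply, smul_apply, smul_eq_mul]
  refine Finset.sum_congr rfl fun j _ ↦ ?_
  rw [g.symm x w, mul_comm]
  rfl

end CoKahler

end

/-- On any coKähler manifold the Ricci operator commutes with `φ`. -/
theorem mainTheorem5 {E : Type*} [NormedAddCommGroup E] [NormedSpace ℝ E] [FiniteDimensional ℝ E]
    {M : Type*} [TopologicalSpace M] [ChartedSpace E M] [IsManifold 𝓘(ℝ, E) ∞ M]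
    (S : CoKahler.AlmostContactStructure E M) (g : CoKahler.RiemannianMetric E M)
    (hS : S.IsCoKahler g) (x : M) (v : TangentSpace 𝓘(ℝ, E) x) :
    S.φ x (CoKahler.ricciOperator g x v) = CoKahler.ricciOperator g x (S.φ x v) := by
  refine CoKahler.inner_ext g fun u ↦ ?_
  rw [hS.inner_φ_left, CoKahler.inner_ricciOperator, CoKahler.inner_ricciOperator,
    hS.ricci_φ_left]
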